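/- For $f\in L^2(\mathbb{R}^n)$ let $\widehat f$ denote its unitary Fourier transform, normalized by $\widehat f(\xi)=(2\pi)^{-n/2}\int e^{-ix\cdot\xi}f(x)\,dx$, and, when $\widehat f$ has compact support, let $$e^{it\Delta}f(x)=(2\pi)^{-n/2}\int_{\mathbb{R}^n} e^{i(x\cdot\xi+t|\xi|^2)}\,\widehat f(\xi)\,d\xi .$$ For $p\in[2,\infty]$ call $\gamma\in\mathbb{R}$ admissible for $(n,p)$ if for every $\varepsilon>0$ there is a constant $C_\varepsilon>0$ such that $$\Big\|\sup_{0<t\le R}|e^{it\Delta}f|\Big\|_{L^p(B^n(0,R))}\le C_\varepsilon R^{\varepsilon}R^{\gamma}\|f\|_{L^2}$$ for all $R>1$ and all $f\in L^2(\mathbb{R}^n)$ with $\operatorname{supp}\widehat f\subset B^n(0,1)$ (that is, $\widehat f=0$ almost everywhere outside the unit ball), and let $\bar\gamma_{n,p}$ be the infimum of the admissible $\gamma$. **Theorem.** Let $n\ge 3$ and $2\le p\le\infty$ (with $1/p=0$ for $p=\infty$). The set of admissible $\gamma$ is non-empty and bounded below, so that $\bar\gamma_{n,p}$ is a real number, and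 for every integer $1\le m\le n$, $$\bar\gamma_{n,p}\ \ge\ \frac{n+m}{2}\Big(\frac1p-\frac12\Big)+\frac{m}{2(m+1)} .$$ -/

import Mathlib

open MeasureTheory
open scoped ENNReal FourierTransform

namespace SchrodingerMaximal

noncomputable section

/-- `ℝⁿ` with its Euclidean norm and inner product. -/
abbrev Rn (n : ℕ) : Type := EuclideanSpace ℝ (Fin n)

/-- The space `L²(ℝⁿ)` of complex-valued functions. -/
abbrev L2 (n : ℕ) : Type := Lp (α := Rn n) ℂ 2

/-- The unitary Fourier transform on `L²(ℝⁿ)` in the angular-frequency normalization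
`f̂(ξ) = (2π)^{-n/2} ∫ e^{-i x·ξ} f(x) dx`. Mathlib's Fourier transform `𝓕` on `L²` extends
`𝓕 f (ξ) = ∫ e^{-2π i x·ξ} f(x) dx`, hence `f̂(ξ) = (2π)^{-n/2} (𝓕 f)(ξ / 2π)`. -/
def hat {n : ℕ} (f : L2 n) (ξ : Rn n) : ℂ :=
  (((2 * Real.pi) ^ (-(n : ℝ) / 2) : ℝ) : ℂ) * (𝓕 f : L2 n) ((2 * Real.pi)⁻¹ • ξ)

/-- `supp f̂ ⊆ B(0,1)`, for the (essential) support of the `L²` function `f̂`: it vanishes almost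
everywhere outside the unit ball. (The unit sphere is a null set.) -/
def FourierSupportedInUnitBall {n : ℕ} (f : L2 n) : Prop :=
  ∀ᵐ ξ : Rn n, ξ ∉ Metric.ball (0 : Rn n) 1 → hat f ξ = 0

/-- `e^{itΔ} f (x) = (2π)^{-n/2} ∫ e^{i (x·ξ + t |ξ|²)} f̂(ξ) dξ`. It is only applied to `f` with
compactly supported `f̂ ∈ L²`, for which the integral converges absolutely. -/
def schrodinger {n : ℕ} (t : ℝ) (f : L2 n) (x : Rn n) : ℂ :=
  (((2 * Real.pi) ^ (-(n : ℝ) / 2) : ℝ) : ℂ) *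
    ∫ ξ : Rn n, Complex.exp (Complex.I * ((inner ℝ x ξ + t * ‖ξ‖ ^ 2 : ℝ) : ℂ)) * hat f ξ

/-- The local maximal function `sup_{0 < t ≤ R} |e^{itΔ} f (x)|`, with values in `[0, ∞]`. -/
def maximalFunction {n : ℕ} (R : ℝ) (f : L2 n) (x : Rn n) : ℝ≥0∞ :=
  ⨆ t ∈ Set.Ioc (0 : ℝ) R, ‖schrodinger t f x‖ₑ

/-- The exponent `γ` is admissible for `(n, p)` if for every `ε > 0` there is a constant `C_ε > 0`
such that `‖sup_{0<t≤R} |e^{itΔ} f|‖_{L^p(B(0,R))} ≤ C_ε R^ε R^γ ‖f‖_{L²}` for all `R > 1` and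
all `f ∈ L²(ℝⁿ)` with `supp f̂ ⊆ B(0,1)`. -/
def IsAdmissible (n : ℕ) (p : ℝ≥0∞) (γ : ℝ) : Prop :=
  ∀ ε : ℝ, 0 < ε → ∃ C : ℝ, 0 < C ∧ ∀ R : ℝ, 1 < R → ∀ f : L2 n,
    FourierSupportedInUnitBall f →
      eLpNorm (maximalFunction R f) p (volume.restrict (Metric.ball (0 : Rn n) R)) ≤
        ENNReal.ofReal (C * R ^ ε * R ^ γ * ‖f‖)

/-- The optimal exponent: the infimum of all admissible exponents. -/
def optimalExponent (n : ℕ) (p : ℝ≥0∞) : ℝ :=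
  sInf {γ : ℝ | IsAdmissible n p γ}

end

end SchrodingerMaximal

/-!
Put `m = d + 1` and `R = K ^ (2 d + 4)`. The example `f` has as `f̂` the indicator of a product: in
the first coordinate an interval of length about `R ^ (-1/2)` near a frequency `κ ≠ 0`, in the
next `d` coordinates a comb of intervals of length about `R⁻¹` with spacing
`σ = 1 / K ^ (d + 1)`, and in the remaining coordinates intervals of length about `R ^ (-1/2)`
at the origin, so that `e^{itΔ} f` factors. At a time `t` with `t σ ^ 2 = π a / q` each comb becomes
a quadratic Gauss sum modulo `q ≲ K ^ d` at the points `x_i` with `σ x_i` close to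
`2 π ℓ / q`, where it loses only a factor `√q` against its trivial bound. The first
coordinate, a wave packet moving with velocity `-2 κ`, singles out the time: every `x` in the large
set has its own `t`. By simultaneous Dirichlet approximation the resonant points
`(x_2, …, x_{d+1})` fill a positive proportion of a cube of side about `R` as `q` varies, and the
wave packet passes through all but a logarithmic loss of the values of `x_1`, the loss coming from
the totient `φ(q)` in the count of numerators `a` prime to `q`. Letting `K → ∞` in the estimate
for `f` compares the exponents.
-/

namespace SchrodingerMaximal

theorem abs_sub_le_inv_of_natFloor_mul_eq {x y : ℝ} {K : ℕ} (hK : 0 < K) (hx : 0 ≤ x) (hy : 0 ≤ y)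
    (hxy : ⌊x * K⌋₊ = ⌊y * K⌋₊) : |y - x| ≤ 1 / K := by
  have hK' : (0 : ℝ) < K := by exact_mod_cast hK
  have hx_le := Nat.floor_le (a := x * K) (by positivity)
  have hy_le := Nat.floor_le (a := y * K) (by positivity)
  have hx_lt := Nat.lt_floor_add_one (x * K)
  have hy_lt := Nat.lt_floor_add_one (y * K)
  rw [← hxy] at hy_le hy_lt
  rw [le_div_iff₀ hK', ← abs_of_pos hK', ← abs_mul, abs_le]
  constructor <;> nlinarith

theorem exists_simultaneous_approx {ι : Type*} [Fintype ι] (y : ι → ℝ) {K : ℕ} (hK : 0 < K) :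
    ∃ q : ℕ, 0 < q ∧ q ≤ K ^ Fintype.card ι ∧ ∀ j, ∃ a : ℤ, |q * y j - a| ≤ 1 / K := by
  classical
  let box : ℕ → ι → Fin K := fun r j => ⟨⌊Int.fract (r * y j) * K⌋₊, by
    have hK' : (0 : ℝ) < K := by exact_mod_cast hK
    rw [Nat.floor_lt (by positivity)]
    nlinarith [Int.fract_lt_one (r * y j)]⟩
  obtain ⟨r, hr, s, hs, hrs, hbox⟩ : ∃ r ∈ Finset.range (K ^ Fintype.card ι + 1),
      ∃ s ∈ Finset.range (K ^ Fintype.card ι + 1), r ≠ s ∧ box r = box s :=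
    Finset.exists_ne_map_eq_of_card_lt_of_maps_to (t := Finset.univ) (by simp)
      fun _ _ => Finset.mem_coe.2 (Finset.mem_univ _)
  wlog hlt : r < s generalizing r s
  · exact this s hs r hr hrs.symm hbox.symm (by lia)
  rw [Finset.mem_range] at hs
  refine ⟨s - r, by lia, by lia, fun j => ⟨⌊s * y j⌋ - ⌊r * y j⌋, ?_⟩⟩
  have hdiff : ((s - r : ℕ) : ℝ) * y j - ((⌊s * y j⌋ - ⌊r * y j⌋ : ℤ) : ℝ)
      = Int.fract (s * y j) - Int.fract (r * y j) := by
    rw [Nat.cast_sub hlt.le]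
    push_cast
    simp only [Int.fract]
    ring
  rw [hdiff]
  exact abs_sub_le_inv_of_natFloor_mul_eq hK (Int.fract_nonneg _) (Int.fract_nonneg _)
    (congrArg Fin.val (congrFun hbox j))

theorem card_add_two_le_of_forall_lt {S : Finset ℕ} {a : ℕ} (ha : 2 ≤ a)
    (hS : ∀ p ∈ S, 2 ≤ p ∧ p < a) : S.card + 2 ≤ a := by
  have hcard := Finset.card_le_card (fun p hp => Finset.mem_Ico.2 (hS p hp) : S ⊆ Finset.Ico 2 a)
  rw [Nat.card_Ico] at hcard
  lia

-- The `j`-th smallest element is at least `j + 1`, so the product telescopes.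
theorem inv_card_add_one_le_prod_one_sub_inv {S : Finset ℕ} (hS : ∀ p ∈ S, 2 ≤ p) :
    ((S.card : ℝ) + 1)⁻¹ ≤ ∏ p ∈ S, (1 - (p : ℝ)⁻¹) := by
  induction S using Finset.induction_on_max with
  | empty => simp
  | insert a S ha ih =>
    have ha_notMem : a ∉ S := fun h => lt_irrefl _ (ha a h)
    have ih := ih fun p hp => hS p (Finset.mem_insert_of_mem hp)
    have hcard : (S.card : ℝ) + 2 ≤ a := by
      exact_mod_cast card_add_two_le_of_forall_lt (hS a (Finset.mem_insert_self _ _))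
        fun p hp => ⟨hS p (Finset.mem_insert_of_mem hp), ha p hp⟩
    have hinv : (a : ℝ)⁻¹ ≤ ((S.card : ℝ) + 2)⁻¹ := inv_anti₀ (by positivity) hcard
    rw [Finset.prod_insert ha_notMem, Finset.card_insert_of_notMem ha_notMem]
    calc (((S.card + 1 : ℕ) : ℝ) + 1)⁻¹
        = (1 - ((S.card : ℝ) + 2)⁻¹) * ((S.card : ℝ) + 1)⁻¹ := by push_cast; field_simp; ring
      _ ≤ (1 - (a : ℝ)⁻¹) * ∏ p ∈ S, (1 - (p : ℝ)⁻¹) :=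
          mul_le_mul (by linarith) ih (by positivity)
            (sub_nonneg.2 <| inv_le_one_of_one_le₀ <| by linarith [S.card.cast_nonneg (α := ℝ)])

theorem card_primeFactors_le_two_mul_log {q : ℕ} (hq : 0 < q) :
    (q.primeFactors.card : ℝ) ≤ 2 * Real.log q := by
  have hpow : 2 ^ q.primeFactors.card ≤ q :=
    (Finset.pow_card_le_prod _ _ _ fun p hp => (Nat.prime_of_mem_primeFactors hp).two_le).trans
      (Nat.le_of_dvd hq (Nat.prod_primeFactors_dvd q))
  have hlog : (q.primeFactors.card : ℝ) * Real.log 2 ≤ Real.log q := by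
    rw [← Real.log_pow]
    exact Real.log_le_log (by positivity) (by exact_mod_cast hpow)
  nlinarith [Real.log_two_gt_d9, q.primeFactors.card.cast_nonneg (α := ℝ)]

theorem div_one_add_two_mul_log_le_totient {q : ℕ} (hq : 0 < q) :
    (q : ℝ) / (1 + 2 * Real.log q) ≤ q.totient := by
  have hprod : (q.totient : ℝ) = q * ∏ p ∈ q.primeFactors, (1 - (p : ℝ)⁻¹) := by
    have h := congrArg (Rat.cast : ℚ → ℝ) (Nat.totient_eq_mul_prod_factors q)
    push_cast at h
    exact h
  have hcard := card_primeFactors_le_two_mul_log hq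
  calc (q : ℝ) / (1 + 2 * Real.log q)
      ≤ q * ((q.primeFactors.card : ℝ) + 1)⁻¹ := by
        rw [div_eq_mul_inv]
        gcongr ?_ * ?_⁻¹
        linarith
    _ ≤ q.totient := by
        rw [hprod]
        gcongr
        exact inv_card_add_one_le_prod_one_sub_inv
          fun p hp => (Nat.prime_of_mem_primeFactors hp).two_le

theorem card_filter_coprime_Ico_mul (q M : ℕ) :
    ((Finset.Ico 1 (1 + q * M)).filter q.Coprime).card = M * q.totient := by
  induction M with
  | zero => simp
  | succ M ih =>
    have hunion : Finset.Ico 1 (1 + q * (M + 1)) =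
        Finset.Ico 1 (1 + q * M) ∪ Finset.Ico (1 + q * M) (1 + q * M + q) := by
      rw [Finset.Ico_union_Ico_eq_Ico (by lia) (by lia)]
      ring_nf
    rw [hunion, Finset.filter_union, Finset.card_union_of_disjoint
      (Finset.disjoint_filter_filter (Finset.Ico_disjoint_Ico_consecutive _ _ _)), ih,
      Nat.filter_coprime_Ico_eq_totient, add_one_mul]

section GaussSums

variable {q : ℕ}

theorem two_div_pi_mul_min_le_norm_exp_sub_one {y : ℝ} (hy : 0 ≤ y) (hy' : y ≤ 2 * Real.pi) :
    2 / Real.pi * min y (2 * Real.pi - y) ≤ ‖(Circle.exp y : ℂ) - 1‖ := by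
  rw [Circle.coe_exp, mul_comm _ Complex.I, Complex.norm_exp_I_mul_ofReal_sub_one, norm_mul,
    Real.norm_ofNat, Real.norm_eq_abs]
  rcases le_total y Real.pi with h | h
  · calc 2 / Real.pi * min y (2 * Real.pi - y) ≤ 2 / Real.pi * y := by gcongr; exact min_le_left _ _
      _ = 2 * (2 / Real.pi * (y / 2)) := by ring
      _ ≤ 2 * Real.sin (y / 2) := by gcongr; exact Real.mul_le_sin (by linarith) (by linarith)
      _ ≤ _ := by gcongr; exact le_abs_self _
  · calc 2 / Real.pi * min y (2 * Real.pi - y) ≤ 2 / Real.pi * (2 * Real.pi - y) := by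
          gcongr; exact min_le_right _ _
      _ = 2 * (2 / Real.pi * (Real.pi - y / 2)) := by ring
      _ ≤ 2 * Real.sin (Real.pi - y / 2) := by
          gcongr; exact Real.mul_le_sin (by linarith) (by linarith)
      _ ≤ _ := by rw [Real.sin_pi_sub]; gcongr; exact le_abs_self _

theorem norm_exp_two_pi_mul_div_add_sub_one_ge {k : ℕ} (hk : 0 < k) (hkq : k < q) {θ : ℝ}
    (hθ : |θ| ≤ Real.pi / q) :
    2 * (min (k : ℝ) (q - k) / q) ≤ ‖(Circle.exp (2 * Real.pi * k / q + θ) : ℂ) - 1‖ := by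
  have hq : (0 : ℝ) < q := by exact_mod_cast hk.trans hkq
  have hk_one : (1 : ℝ) ≤ k := by exact_mod_cast hk
  have hkq_one : (1 : ℝ) ≤ q - k := by
    rw [le_sub_iff_add_le']
    exact_mod_cast hkq
  obtain ⟨hθ_ge, hθ_le⟩ := abs_le.1 hθ
  set y := 2 * Real.pi * k / q + θ
  have hlow : Real.pi * k / q ≤ y := by
    calc Real.pi * k / q = 2 * Real.pi * k / q - Real.pi / q * k := by ring
      _ ≤ 2 * Real.pi * k / q - Real.pi / q * 1 := by gcongr
      _ ≤ y := by linarith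
  have hhigh : Real.pi * (q - k) / q ≤ 2 * Real.pi - y := by
    calc Real.pi * (q - k) / q = 2 * Real.pi * (q - k) / q - Real.pi / q * (q - k) := by ring
      _ ≤ 2 * Real.pi * (q - k) / q - Real.pi / q * 1 := by gcongr
      _ = 2 * Real.pi - 2 * Real.pi * k / q - Real.pi / q := by field_simp
      _ ≤ 2 * Real.pi - y := by linarith
  have hy_nonneg : 0 ≤ y := le_trans (by positivity) hlow
  have hy_le : 0 ≤ 2 * Real.pi - y :=
    le_trans (div_nonneg (mul_nonneg Real.pi_pos.le (by linarith)) hq.le) hhigh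
  calc 2 * (min (k : ℝ) (q - k) / q)
      = 2 / Real.pi * min (Real.pi * k / q) (Real.pi * (q - k) / q) := by
        rw [min_div_div_right hq.le, ← mul_min_of_nonneg _ _ Real.pi_pos.le]
        field_simp
    _ ≤ 2 / Real.pi * min y (2 * Real.pi - y) := by gcongr
    _ ≤ _ := two_div_pi_mul_min_le_norm_exp_sub_one hy_nonneg (sub_nonneg.1 hy_le)

theorem norm_geom_sum_exp_le {k : ℕ} (hk : 0 < k) (hkq : k < q) {θ : ℝ}
    (hθ : |θ| ≤ Real.pi / q) (L : ℕ) :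
    ‖∑ ℓ ∈ Finset.range L, (Circle.exp (2 * Real.pi * k / q + θ) : ℂ) ^ ℓ‖ ≤
      q * ((k : ℝ)⁻¹ + ((q : ℝ) - k)⁻¹) := by
  have hk_pos : (0 : ℝ) < k := by exact_mod_cast hk
  have hkq_pos : (0 : ℝ) < q - k := by
    rw [sub_pos]
    exact_mod_cast hkq
  have hdist := norm_exp_two_pi_mul_div_add_sub_one_ge hk hkq hθ
  set w : ℂ := (Circle.exp (2 * Real.pi * k / q + θ) : ℂ) with hw
  have hdist_pos : 0 < 2 * (min (k : ℝ) (q - k) / q) := by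
    have hq : (0 : ℝ) < q := by linarith
    positivity
  have hw_ne : w ≠ 1 := sub_ne_zero.1 (norm_pos_iff.1 (hdist_pos.trans_le hdist))
  have hnum : ‖w ^ L - 1‖ ≤ 2 := by
    refine (norm_sub_le _ _).trans (le_of_eq ?_)
    rw [norm_pow, hw, Circle.norm_coe]
    norm_num
  rw [geom_sum_eq hw_ne, norm_div]
  calc ‖w ^ L - 1‖ / ‖w - 1‖ ≤ 2 / (2 * (min (k : ℝ) (q - k) / q)) := by gcongr
    _ = q * (min (k : ℝ) (q - k))⁻¹ := by field_simp
    _ ≤ q * ((k : ℝ)⁻¹ + ((q : ℝ) - k)⁻¹) := by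
      gcongr
      rcases min_choice (k : ℝ) (q - k) with h | h <;> rw [h]
      · exact le_add_of_nonneg_right (inv_nonneg.2 hkq_pos.le)
      · exact le_add_of_nonneg_left (inv_nonneg.2 hk_pos.le)

theorem sum_Ico_inv_add_inv_sub_le (q : ℕ) :
    ∑ k ∈ Finset.Ico 1 q, ((k : ℝ)⁻¹ + ((q : ℝ) - k)⁻¹) ≤ 2 * (1 + Real.log q) := by
  have hreflect : ∑ k ∈ Finset.Ico 1 q, ((q : ℝ) - k)⁻¹ = ∑ k ∈ Finset.Ico 1 q, (k : ℝ)⁻¹ := by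
    have h := Finset.sum_Ico_reflect (fun k : ℕ => (k : ℝ)⁻¹) 1 (Nat.le_succ q)
    simp only [Nat.add_sub_cancel_left, Nat.add_sub_cancel] at h
    rw [← h]
    exact Finset.sum_congr rfl fun k hk => by rw [Nat.cast_sub (Finset.mem_Ico.1 hk).2.le]
  have hharmonic : ∑ k ∈ Finset.Ico 1 q, (k : ℝ)⁻¹ ≤ 1 + Real.log q := by
    have h := harmonic_le_one_add_log q
    rw [harmonic_eq_sum_Icc] at h
    push_cast at h
    exact (Finset.sum_le_sum_of_subset_of_nonneg Finset.Ico_subset_Icc_self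
      fun _ _ _ => by positivity).trans h
  rw [Finset.sum_add_distrib, hreflect]
  linarith

/-- The quadratic phase `ℓ ↦ exp (π i (b ℓ² + 2 a ℓ) / q)`. -/
noncomputable def quadPhase (q : ℕ) (b a ℓ : ℤ) : Circle :=
  Circle.exp (Real.pi * (b * ℓ ^ 2 + 2 * a * ℓ) / q)

theorem quadPhase_add (b a x y : ℤ) :
    quadPhase q b a (x + y) =
      quadPhase q b a x * quadPhase q b a y * Circle.exp (2 * Real.pi * (b * x * y) / q) := by
  simp only [quadPhase, ← Circle.exp_add]
  congr 1
  push_cast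
  ring

variable [NeZero q]

/-- A unimodular function on `ℤ / q` is a quadratic phase with polar form `(x, y) ↦ u x y` if it
is a character up to the factor `e(u x y / q)`; when `u` is a unit, its sum is a Gauss sum. -/
def IsQuadraticPhase (u : ZMod q) (f : ZMod q → Circle) : Prop :=
  ∀ x y, f (x + y) = f x * f y * ZMod.toCircle (u * x * y)

namespace IsQuadraticPhase

variable {u : ZMod q} {f : ZMod q → Circle}

theorem map_zero (hf : IsQuadraticPhase u f) : f 0 = 1 := by
  simpa using hf 0 0

theorem mul_toCircle (hf : IsQuadraticPhase u f) (k : ZMod q) :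
    IsQuadraticPhase u fun x => ZMod.toCircle (k * x) * f x := fun x y => by
  simp only [hf x y, mul_add, AddChar.map_add_eq_mul]
  ac_rfl

theorem sum_mul_conj_sum (hf : IsQuadraticPhase u f) (hu : IsUnit u) :
    (∑ x, (f x : ℂ)) * (starRingEnd ℂ) (∑ x, (f x : ℂ)) = q := by
  have hterm (x y : ZMod q) : (f (x + y) : ℂ) * (starRingEnd ℂ) (f y : ℂ) =
      f x * ZMod.stdAddChar (y * (u * x)) := by
    rw [← Circle.coe_inv_eq_conj, hf x y, ZMod.stdAddChar_apply, ← Circle.coe_mul,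
      ← Circle.coe_mul, mul_comm y, mul_right_comm, mul_inv_cancel_right]
  calc (∑ x, (f x : ℂ)) * (starRingEnd ℂ) (∑ x, (f x : ℂ))
      = ∑ y, ∑ x, (f (x + y) : ℂ) * (starRingEnd ℂ) (f y : ℂ) := by
        rw [map_sum, Finset.mul_sum]
        refine Finset.sum_congr rfl fun y _ => ?_
        rw [← Finset.sum_mul]
        congr 1
        exact (Equiv.sum_comp (Equiv.addRight y) fun x => (f x : ℂ)).symm
    _ = ∑ x, (f x : ℂ) * ∑ y, ZMod.stdAddChar (y * (u * x)) := by
        simp_rw [hterm, Finset.mul_sum]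
        exact Finset.sum_comm
    _ = ∑ x, if x = 0 then (q : ℂ) * f x else 0 := by
        refine Finset.sum_congr rfl fun x _ => ?_
        rw [AddChar.sum_mulShift _ (ZMod.isPrimitive_stdAddChar q), ZMod.card]
        by_cases hx : x = 0 <;> simp [hx, hu.mul_right_eq_zero, mul_comm]
    _ = q := by
        rw [Finset.sum_ite_eq' Finset.univ (0 : ZMod q) fun x => (q : ℂ) * f x]
        simp [hf.map_zero]

theorem norm_sum (hf : IsQuadraticPhase u f) (hu : IsUnit u) : ‖∑ x, (f x : ℂ)‖ = √q := by
  have hsq := hf.sum_mul_conj_sum hu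
  rw [Complex.mul_conj, Complex.normSq_eq_norm_sq] at hsq
  rw [← Real.sqrt_sq (norm_nonneg _)]
  congr 1
  exact_mod_cast hsq

theorem norm_dft (hf : IsQuadraticPhase u f) (hu : IsUnit u) (k : ZMod q) :
    ‖ZMod.dft (fun x => (f x : ℂ)) k‖ = √q := by
  rw [← (hf.mul_toCircle (-k)).norm_sum hu, ZMod.dft_apply]
  congr 1
  refine Finset.sum_congr rfl fun x _ => ?_
  rw [ZMod.stdAddChar_apply, smul_eq_mul, Circle.coe_mul, neg_mul, mul_comm x]

end IsQuadraticPhase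

theorem quadPhase_periodic {b : ℤ} (hb : Even (b * q)) (a : ℤ) :
    Function.Periodic (quadPhase q b a) q := fun ℓ => by
  obtain ⟨c, hc⟩ := hb
  have hc' : (b : ℝ) * q = c + c := by exact_mod_cast hc
  refine Circle.exp_eq_exp.2 ⟨b * ℓ + c + a, ?_⟩
  field_simp [NeZero.ne (q : ℝ)]
  push_cast
  linear_combination (q : ℝ) * hc'

theorem toCircle_intCast_eq_exp (j : ℤ) :
    ZMod.toCircle (j : ZMod q) = Circle.exp (2 * Real.pi * j / q) := by
  refine Circle.coe_injective ?_
  rw [ZMod.toCircle_intCast, Circle.coe_exp]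
  congr 1
  push_cast
  ring

theorem exists_isQuadraticPhase_forall_eq_quadPhase {b : ℤ} (hb : Even (b * q)) (a : ℤ) :
    ∃ f : ZMod q → Circle, IsQuadraticPhase (b : ZMod q) f ∧ ∀ ℓ : ℤ, f ℓ = quadPhase q b a ℓ := by
  have hval (ℓ : ℤ) : quadPhase q b a (ℓ : ZMod q).val = quadPhase q b a ℓ := by
    rw [ZMod.val_intCast, Int.emod_def, mul_comm (q : ℤ)]
    exact (quadPhase_periodic hb a).sub_int_mul_eq (ℓ / q)
  refine ⟨fun x => quadPhase q b a x.val, fun x y => ?_, hval⟩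
  obtain ⟨x, rfl⟩ := ZMod.intCast_surjective x
  obtain ⟨y, rfl⟩ := ZMod.intCast_surjective y
  have hcast : (b * x * y : ZMod q) = ((b * x * y : ℤ) : ZMod q) := by push_cast; rfl
  simp only [← Int.cast_add, hval]
  rw [quadPhase_add, hcast, toCircle_intCast_eq_exp]
  push_cast
  rfl

theorem sum_erase_zero_eq_sum_Ico {M : Type*} [AddCommMonoid M] (h : ℕ → M) :
    ∑ k ∈ Finset.univ.erase (0 : ZMod q), h k.val = ∑ k ∈ Finset.Ico 1 q, h k := by
  refine Finset.sum_nbij' ZMod.val (fun k : ℕ => (k : ZMod q)) (fun k hk => ?_) (fun k hk => ?_)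
    (fun k _ => ZMod.natCast_zmod_val k)
    (fun k hk => ZMod.val_cast_of_lt (Finset.mem_Ico.1 hk).2) fun _ _ => rfl
  · exact Finset.mem_Ico.2
      ⟨ZMod.val_pos.2 (Finset.ne_of_mem_erase hk), ZMod.val_lt k⟩
  · obtain ⟨hk_pos, hk_lt⟩ := Finset.mem_Ico.1 hk
    refine Finset.mem_erase.2 ⟨fun h => ?_, Finset.mem_univ _⟩
    have := ZMod.val_cast_of_lt hk_lt
    rw [h, ZMod.val_zero] at this
    lia

theorem sum_range_eq_sum_dft_mul_geom_sum (f : ZMod q → ℂ) (L : ℕ) (θ : ℝ) :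
    ∑ ℓ ∈ Finset.range L, f ℓ * (Circle.exp (θ * ℓ) : ℂ) =
      ∑ k : ZMod q, (q : ℂ)⁻¹ * ZMod.dft f k *
        ∑ ℓ ∈ Finset.range L, (Circle.exp (2 * Real.pi * k.val / q + θ) : ℂ) ^ ℓ := by
  have hcharacter (k : ZMod q) (ℓ : ℕ) :
      (Circle.exp (2 * Real.pi * k.val / q + θ) : ℂ) ^ ℓ =
        ZMod.stdAddChar (k * (ℓ : ZMod q)) * (Circle.exp (θ * ℓ) : ℂ) := by
    rw [mul_comm k, ← nsmul_eq_mul, AddChar.map_nsmul_eq_pow, ZMod.stdAddChar_apply,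
      ZMod.toCircle_eq_circleExp, mul_comm θ, Circle.exp_natCast_mul, Circle.coe_pow, ← mul_pow,
      ← Circle.coe_mul, ← Circle.exp_add, mul_div_assoc]
  simp_rw [Finset.mul_sum]
  rw [Finset.sum_comm]
  refine Finset.sum_congr rfl fun ℓ _ => ?_
  conv_lhs => rw [← ZMod.dft.symm_apply_apply f, ZMod.invDFT_apply]
  simp_rw [smul_eq_mul, Finset.mul_sum, Finset.sum_mul]
  refine Finset.sum_congr rfl fun k _ => ?_
  rw [hcharacter]
  ring

/- In the finite Fourier expansion of `f` every coefficient has modulus `q ^ (-1/2)`, but only the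
frequency `0` is close to the slow frequency `θ`: the other geometric sums are bounded. -/
theorem IsQuadraticPhase.exists_norm_sum_range_sub_le {u : ZMod q} {f : ZMod q → Circle}
    (hf : IsQuadraticPhase u f) (hu : IsUnit u) (L : ℕ) :
    ∃ g : ℂ, ‖g‖ = (√q)⁻¹ ∧ ∀ θ : ℝ, |θ| ≤ Real.pi / q →
      ‖∑ ℓ ∈ Finset.range L, (f ℓ : ℂ) * (Circle.exp (θ * ℓ) : ℂ) -
        g * ∑ ℓ ∈ Finset.range L, (Circle.exp (θ * ℓ) : ℂ)‖ ≤
        (√q)⁻¹ * (q * (2 * (1 + Real.log q))) := by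
  have hq : (0 : ℝ) < q := by exact_mod_cast NeZero.pos q
  set c : ZMod q → ℂ := fun k => (q : ℂ)⁻¹ * ZMod.dft (fun x => (f x : ℂ)) k with hc
  have hc_norm (k : ZMod q) : ‖c k‖ = (√q)⁻¹ := by
    rw [hc, norm_mul, norm_inv, Complex.norm_natCast, hf.norm_dft hu]
    field_simp
    exact Real.sq_sqrt hq.le
  refine ⟨c 0, hc_norm 0, fun θ hθ => ?_⟩
  set G : ℕ → ℂ := fun k =>
    ∑ ℓ ∈ Finset.range L, (Circle.exp (2 * Real.pi * k / q + θ) : ℂ) ^ ℓ with hG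
  have hG_zero : ∑ ℓ ∈ Finset.range L, (Circle.exp (θ * ℓ) : ℂ) = G (0 : ZMod q).val := by
    simp [hG, mul_comm θ, Circle.exp_natCast_mul]
  calc ‖∑ ℓ ∈ Finset.range L, (f ℓ : ℂ) * (Circle.exp (θ * ℓ) : ℂ) -
        c 0 * ∑ ℓ ∈ Finset.range L, (Circle.exp (θ * ℓ) : ℂ)‖
      = ‖∑ k ∈ Finset.univ.erase (0 : ZMod q), c k * G k.val‖ := by
        rw [sum_range_eq_sum_dft_mul_geom_sum (fun x => (f x : ℂ)), hG_zero,
          Finset.sum_erase_eq_sub (Finset.mem_univ _)]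
    _ ≤ ∑ k ∈ Finset.univ.erase (0 : ZMod q), ‖c k * G k.val‖ := norm_sum_le _ _
    _ = (√q)⁻¹ * ∑ k ∈ Finset.Ico 1 q, ‖G k‖ := by
        simp_rw [norm_mul, hc_norm]
        rw [← Finset.mul_sum, sum_erase_zero_eq_sum_Ico fun k => ‖G k‖]
    _ ≤ (√q)⁻¹ * ∑ k ∈ Finset.Ico 1 q, q * ((k : ℝ)⁻¹ + ((q : ℝ) - k)⁻¹) := by
        gcongr with k hk
        obtain ⟨hk_pos, hk_lt⟩ := Finset.mem_Ico.1 hk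
        exact norm_geom_sum_exp_le hk_pos hk_lt hθ L
    _ ≤ (√q)⁻¹ * (q * (2 * (1 + Real.log q))) := by
        rw [← Finset.mul_sum]
        gcongr
        exact sum_Ico_inv_add_inv_sub_le q

end GaussSums

theorem exists_norm_sum_quadPhase_sub_le {q : ℕ} (hq : 0 < q) {b : ℤ} (hb : Even (b * q))
    (hbq : IsCoprime b (q : ℤ)) (a : ℤ) (L : ℕ) :
    ∃ g : ℂ, ‖g‖ = (√q)⁻¹ ∧ ∀ θ : ℝ, |θ| ≤ Real.pi / q →
      ‖∑ ℓ ∈ Finset.range L, (quadPhase q b a ℓ : ℂ) * (Circle.exp (θ * ℓ) : ℂ) -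
        g * ∑ ℓ ∈ Finset.range L, (Circle.exp (θ * ℓ) : ℂ)‖ ≤
        (√q)⁻¹ * (q * (2 * (1 + Real.log q))) := by
  have : NeZero q := ⟨hq.ne'⟩
  obtain ⟨f, hf, hf_eq⟩ := exists_isQuadraticPhase_forall_eq_quadPhase hb a
  simpa only [← hf_eq, Int.cast_natCast] using
    hf.exists_norm_sum_range_sub_le ((ZMod.coe_int_isUnit_iff_isCoprime b q).2 hbq.symm) L

/-- The one-dimensional Schrödinger oscillation `exp (i (x ξ + t ξ²))`. -/
noncomputable def osc (x t ξ : ℝ) : ℂ :=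
  (Circle.exp (x * ξ + t * ξ ^ 2) : ℂ)

@[fun_prop]
theorem continuous_osc (x t : ℝ) : Continuous (osc x t) := by
  unfold osc
  fun_prop

theorem norm_osc (x t ξ : ℝ) : ‖osc x t ξ‖ = 1 :=
  Circle.norm_coe _

theorem half_le_re_exp_of_abs_le_one {s : ℝ} (hs : |s| ≤ 1) : 1 / 2 ≤ (Circle.exp s : ℂ).re := by
  rw [Circle.coe_exp, Complex.exp_ofReal_mul_I_re]
  linarith [Real.one_sub_sq_div_two_le_cos (x := s), (sq_le_one_iff_abs_le_one s).2 hs]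

theorem mul_le_norm_integral_of_le_re {w c : ℝ} (hw : 0 ≤ w) {F : ℝ → ℂ} (hF : Continuous F)
    (h : ∀ u ∈ Set.Icc 0 w, c ≤ (F u).re) : w * c ≤ ‖∫ u in (0 : ℝ)..w, F u‖ := by
  calc w * c = ∫ _ in (0 : ℝ)..w, c := by simp
    _ ≤ ∫ u in (0 : ℝ)..w, (F u).re :=
        intervalIntegral.integral_mono_on hw (continuous_const.intervalIntegrable 0 w)
          ((Complex.continuous_re.comp hF).intervalIntegrable 0 w) h
    _ = (∫ u in (0 : ℝ)..w, F u).re := by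
        simpa using Complex.reCLM.intervalIntegral_comp_comm
          (hF.intervalIntegrable (μ := volume) 0 w)
    _ ≤ _ := Complex.re_le_norm _

theorem mul_le_norm_integral_of_norm_sub_mul_le {w c ε : ℝ} (hw : 0 ≤ w) {F D : ℝ → ℂ}
    (hF : Continuous F) (hD : Continuous D) {g : ℂ}
    (hFD : ∀ u ∈ Set.Icc 0 w, ‖F u - g * D u‖ ≤ ε) (hc : ∀ u ∈ Set.Icc 0 w, c ≤ (D u).re) :
    w * (‖g‖ * c - ε) ≤ ‖∫ u in (0 : ℝ)..w, F u‖ := by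
  have herror : ‖∫ u in (0 : ℝ)..w, (F u - g * D u)‖ ≤ ε * w := by
    have h := intervalIntegral.norm_integral_le_of_norm_le_const
      (f := fun u => F u - g * D u) fun u hu => by
        rw [Set.uIoc_of_le hw] at hu
        exact hFD u ⟨hu.1.le, hu.2⟩
    rwa [sub_zero, abs_of_nonneg hw] at h
  have hmain : ‖g‖ * (w * c) ≤ ‖g * ∫ u in (0 : ℝ)..w, D u‖ := by
    rw [norm_mul]
    gcongr
    exact mul_le_norm_integral_of_le_re hw hD hc
  have hsplit : ∫ u in (0 : ℝ)..w, F u =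
      (g * ∫ u in (0 : ℝ)..w, D u) + ∫ u in (0 : ℝ)..w, (F u - g * D u) := by
    rw [intervalIntegral.integral_sub (hF.intervalIntegrable _ _)
      (Continuous.intervalIntegrable (by fun_prop) _ _), intervalIntegral.integral_const_mul]
    ring
  rw [hsplit]
  linarith [norm_sub_le_norm_add (g * ∫ u in (0 : ℝ)..w, D u) (∫ u in (0 : ℝ)..w, (F u - g * D u))]

theorem setIntegral_Ioc_osc_eq (x t c : ℝ) {w : ℝ} (hw : 0 ≤ w) :
    ∫ ξ in Set.Ioc c (c + w), osc x t ξ = ∫ u in (0 : ℝ)..w, osc x t (c + u) := by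
  rw [intervalIntegral.integral_comp_add_left (fun ξ => osc x t ξ) c, add_zero,
    intervalIntegral.integral_of_le (by linarith)]

theorem half_le_norm_setIntegral_Ioc_osc {x t c w : ℝ} (hw : 0 ≤ w)
    (h : ∀ u ∈ Set.Icc 0 w, |x * u + t * (2 * c * u + u ^ 2)| ≤ 1) :
    w / 2 ≤ ‖∫ ξ in Set.Ioc c (c + w), osc x t ξ‖ := by
  have hfactor (u : ℝ) : osc x t (c + u) =
      osc x t c * (Circle.exp (x * u + t * (2 * c * u + u ^ 2)) : ℂ) := by
    rw [osc, osc, ← Circle.coe_mul, ← Circle.exp_add]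
    ring_nf
  simp_rw [setIntegral_Ioc_osc_eq x t c hw, hfactor]
  rw [intervalIntegral.integral_const_mul, norm_mul, norm_osc, one_mul, div_eq_mul_one_div]
  exact mul_le_norm_integral_of_le_re hw (by fun_prop)
    fun u hu => half_le_re_exp_of_abs_le_one (h u hu)

section Comb

/-- The comb with `L` teeth of width `w` and spacing `σ`: in each of the first `d` coordinates the
extremal functions have their Fourier transform supported on such a set. -/
def comb (σ w : ℝ) (L : ℕ) : Set ℝ :=
  ⋃ ℓ ∈ Finset.range L, Set.Ioc (σ * ℓ) (σ * ℓ + w)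

variable {σ w : ℝ}

theorem measurableSet_comb (σ w : ℝ) (L : ℕ) : MeasurableSet (comb σ w L) :=
  Finset.measurableSet_biUnion _ fun _ _ => measurableSet_Ioc

theorem pairwise_disjoint_teeth (hσ : 0 ≤ σ) (hwσ : w ≤ σ) :
    Pairwise (Function.onFun Disjoint fun ℓ : ℕ => Set.Ioc (σ * ℓ) (σ * ℓ + w)) := by
  refine (pairwise_disjoint_on _).2 fun i j hij => Set.disjoint_left.2 fun y hy hy' => ?_
  have hij' : (i : ℝ) + 1 ≤ j := by exact_mod_cast hij
  nlinarith [hy.2, hy'.1]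

theorem volume_comb (hσ : 0 ≤ σ) (hwσ : w ≤ σ) (L : ℕ) :
    volume (comb σ w L) = ENNReal.ofReal (L * w) := by
  rw [comb, measure_biUnion_finset ((pairwise_disjoint_teeth hσ hwσ).set_pairwise _)
    fun _ _ => measurableSet_Ioc]
  simp [Real.volume_Ioc, ENNReal.ofReal_mul]

theorem setIntegral_comb_osc_eq (hw : 0 ≤ w) (hwσ : w ≤ σ) (x t : ℝ) (L : ℕ) :
    ∫ ξ in comb σ w L, osc x t ξ =
      ∫ u in (0 : ℝ)..w, ∑ ℓ ∈ Finset.range L, osc x t (σ * ℓ + u) := by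
  rw [comb, integral_biUnion_finset _ (fun _ _ => measurableSet_Ioc)
    ((pairwise_disjoint_teeth (hw.trans hwσ) hwσ).set_pairwise _) fun ℓ _ =>
    (continuous_osc x t).continuousOn.integrableOn_Icc.mono_set Set.Ioc_subset_Icc_self,
    intervalIntegral.integral_finsetSum fun ℓ _ => Continuous.intervalIntegrable (by fun_prop) _ _]
  exact Finset.sum_congr rfl fun ℓ _ => setIntegral_Ioc_osc_eq x t _ hw

variable {x t β : ℝ} {q L : ℕ} {b a : ℤ}

theorem osc_tooth_eq (ht : t * σ ^ 2 = Real.pi * b / q) (hx : σ * x = 2 * Real.pi * a / q + β)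
    (u : ℝ) (ℓ : ℕ) :
    osc x t (σ * ℓ + u) = osc x t u *
      ((quadPhase q b a ℓ : ℂ) * (Circle.exp ((β + 2 * t * σ * u) * ℓ) : ℂ)) := by
  rw [osc, osc, quadPhase, ← Circle.coe_mul, ← Circle.coe_mul, ← Circle.exp_add, ← Circle.exp_add]
  congr 2
  have hexpand : x * (σ * ℓ + u) + t * (σ * ℓ + u) ^ 2 =
      x * u + t * u ^ 2 + ((σ * x) * ℓ + (t * σ ^ 2) * ℓ ^ 2 + 2 * t * σ * u * ℓ) := by ring
  rw [hexpand, ht, hx]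
  push_cast
  ring

theorem half_le_re_osc_mul_sum_exp {u θ : ℝ}
    (hψ : ∀ ℓ < L, |x * u + t * u ^ 2 + θ * ℓ| ≤ 1) :
    (L / 2 : ℝ) ≤ (osc x t u * ∑ ℓ ∈ Finset.range L, (Circle.exp (θ * ℓ) : ℂ)).re := by
  have hterm : ∀ ℓ ∈ Finset.range L, (1 / 2 : ℝ) ≤ (osc x t u * (Circle.exp (θ * ℓ) : ℂ)).re := by
    intro ℓ hℓ
    rw [osc, ← Circle.coe_mul, ← Circle.exp_add]
    exact half_le_re_exp_of_abs_le_one (hψ ℓ (Finset.mem_range.1 hℓ))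
  have hsum := Finset.card_nsmul_le_sum _ _ _ hterm
  rw [Finset.card_range, nsmul_eq_mul] at hsum
  rw [Finset.mul_sum, Complex.re_sum]
  linarith

theorem le_norm_setIntegral_comb_osc (hw : 0 ≤ w) (hwσ : w ≤ σ) (hq : 0 < q)
    (hb : Even (b * q)) (hbq : IsCoprime b (q : ℤ))
    (ht : t * σ ^ 2 = Real.pi * b / q) (hx : σ * x = 2 * Real.pi * a / q + β)
    (hθ : ∀ u ∈ Set.Icc 0 w, |β + 2 * t * σ * u| ≤ Real.pi / q)
    (hψ : ∀ u ∈ Set.Icc 0 w, ∀ ℓ < L, |x * u + t * u ^ 2 + (β + 2 * t * σ * u) * ℓ| ≤ 1) :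
    w * (√q)⁻¹ * (L / 2 - q * (2 * (1 + Real.log q))) ≤ ‖∫ ξ in comb σ w L, osc x t ξ‖ := by
  obtain ⟨g, hg, hcompare⟩ := exists_norm_sum_quadPhase_sub_le hq hb hbq a L
  rw [setIntegral_comb_osc_eq hw hwσ, mul_assoc, mul_sub, ← hg]
  refine mul_le_norm_integral_of_norm_sub_mul_le hw (by fun_prop)
    (D := fun u => osc x t u * ∑ ℓ ∈ Finset.range L, (Circle.exp ((β + 2 * t * σ * u) * ℓ) : ℂ))
    (by fun_prop) (g := g) (fun u hu => ?_) fun u hu => half_le_re_osc_mul_sum_exp (hψ u hu)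
  simp_rw [osc_tooth_eq ht hx, ← Finset.mul_sum]
  rw [mul_left_comm g, ← mul_sub, norm_mul, norm_osc, one_mul, hg]
  exact hcompare _ (hθ u hu)

end Comb

section FourierSide

variable {n : ℕ}

theorem quasiMeasurePreserving_const_smul {r : ℝ} (hr : r ≠ 0) :
    Measure.QuasiMeasurePreserving (fun ξ : Rn n => r • ξ) volume volume :=
  ⟨by fun_prop, by
    rw [Measure.map_addHaar_smul _ hr]
    exact Measure.smul_absolutelyContinuous⟩

theorem aestronglyMeasurable_hat (f : L2 n) : AEStronglyMeasurable (hat f) volume :=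
  ((Lp.aestronglyMeasurable (𝓕 f : L2 n)).comp_quasiMeasurePreserving
    (quasiMeasurePreserving_const_smul (inv_ne_zero Real.two_pi_pos.ne'))).const_mul _

theorem eLpNorm_comp_smul {r : ℝ} (hr : 0 < r) (g : L2 n) :
    eLpNorm ((g : Rn n → ℂ) ∘ fun ξ => r • ξ) 2 volume =
      ENNReal.ofReal (r ^ (-(n : ℝ) / 2)) * ‖g‖ₑ := by
  have hmap : Measure.map (fun ξ : Rn n => r • ξ) volume =
      ENNReal.ofReal (r ^ (-(n : ℝ))) • (volume : Measure (Rn n)) := by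
    rw [Measure.map_addHaar_smul _ hr.ne', abs_of_pos (by positivity), finrank_euclideanSpace_fin,
      Real.rpow_neg hr.le, Real.rpow_natCast]
  have hg : AEStronglyMeasurable (g : Rn n → ℂ) (Measure.map (fun ξ : Rn n => r • ξ) volume) := by
    rw [hmap]
    exact (Lp.aestronglyMeasurable g).smul_measure _
  rw [← eLpNorm_map_measure hg (by fun_prop), hmap, eLpNorm_smul_measure_of_ne_top (by norm_num),
    smul_eq_mul, ← Lp.enorm_def, ENNReal.ofReal_rpow_of_nonneg (by positivity) (by positivity),
    ← Real.rpow_mul hr.le]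
  norm_num [div_eq_mul_inv]

theorem eLpNorm_hat (f : L2 n) : eLpNorm (hat f) 2 volume = ‖f‖ₑ := by
  have hnorm : ‖(𝓕 f : L2 n)‖ₑ = ‖f‖ₑ := by
    rw [← ofReal_norm, ← ofReal_norm, Lp.norm_fourier_eq]
  have hhat : hat f = (((2 * Real.pi) ^ (-(n : ℝ) / 2) : ℝ) : ℂ) •
      ((𝓕 f : L2 n) ∘ fun ξ : Rn n => (2 * Real.pi)⁻¹ • ξ) := rfl
  rw [hhat, eLpNorm_const_smul, eLpNorm_comp_smul (by positivity), hnorm, ← mul_assoc,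
    ← ofReal_norm, Complex.norm_real, Real.norm_of_nonneg (by positivity),
    ← ENNReal.ofReal_mul (by positivity), ← Real.mul_rpow (by positivity) (by positivity),
    mul_inv_cancel₀ (by positivity), Real.one_rpow, ENNReal.ofReal_one, one_mul]

theorem exists_hat_ae_eq_indicator {Ω : Set (Rn n)} (hΩ : MeasurableSet Ω) (hfin : volume Ω ≠ ∞) :
    ∃ f : L2 n, hat f =ᵐ[volume] Ω.indicator 1 := by
  set c : ℂ := (((2 * Real.pi) ^ (-(n : ℝ) / 2) : ℝ) : ℂ) with hc
  have hc_ne : c ≠ 0 := by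
    rw [hc, Complex.ofReal_ne_zero]
    positivity
  set Ω' : Set (Rn n) := (fun η : Rn n => (2 * Real.pi) • η) ⁻¹' Ω with hΩ'
  have hfin' : volume Ω' ≠ ∞ := by
    rw [hΩ', Measure.addHaar_preimage_smul _ Real.two_pi_pos.ne']
    exact ENNReal.mul_ne_top ENNReal.ofReal_ne_top hfin
  set g : L2 n := indicatorConstLp 2 (hΩ.preimage (by fun_prop) : MeasurableSet Ω') hfin' c⁻¹
  have hg_eq : ∀ᵐ η : Rn n, g η = Ω'.indicator (fun _ => c⁻¹) η := indicatorConstLp_coeFn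
  refine ⟨𝓕⁻ g, ?_⟩
  filter_upwards [(quasiMeasurePreserving_const_smul (inv_ne_zero Real.two_pi_pos.ne')).ae hg_eq]
    with ξ hξ
  have hmem : (2 * Real.pi)⁻¹ • ξ ∈ Ω' ↔ ξ ∈ Ω := by
    rw [hΩ', Set.mem_preimage, smul_inv_smul₀ Real.two_pi_pos.ne']
  rw [hat, FourierTransform.fourier_fourierInv_eq g, hξ]
  by_cases h : ξ ∈ Ω
  · rw [Set.indicator_of_mem h, Set.indicator_of_mem (hmem.2 h), mul_inv_cancel₀ hc_ne,
      Pi.one_apply]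
  · rw [Set.indicator_of_notMem h, Set.indicator_of_notMem (mt hmem.1 h), mul_zero]

section IndicatorData

variable {f : L2 n} {Ω : Set (Rn n)}

theorem fourierSupportedInUnitBall_of_hat_ae_eq_indicator (hf : hat f =ᵐ[volume] Ω.indicator 1)
    (hball : Ω ⊆ Metric.ball 0 1) : FourierSupportedInUnitBall f := by
  filter_upwards [hf] with ξ hξ hξ_notMem
  rw [hξ, Set.indicator_of_notMem fun h => hξ_notMem (hball h)]

theorem norm_eq_of_hat_ae_eq_indicator (hf : hat f =ᵐ[volume] Ω.indicator 1)
    (hΩ : MeasurableSet Ω) : ‖f‖ = √(volume.real Ω) := by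
  have h : ‖f‖ₑ = volume Ω ^ (1 / 2 : ℝ) := by
    rw [← eLpNorm_hat, eLpNorm_congr_ae hf, Pi.one_def,
      eLpNorm_indicator_const hΩ (by norm_num) (by norm_num)]
    simp
  rw [← toReal_enorm, h, ← ENNReal.toReal_rpow, Real.sqrt_eq_rpow, measureReal_def]

theorem norm_schrodinger_of_hat_ae_eq_indicator (hf : hat f =ᵐ[volume] Ω.indicator 1)
    (hΩ : MeasurableSet Ω) (t : ℝ) (x : Rn n) :
    ‖schrodinger t f x‖ = (2 * Real.pi) ^ (-(n : ℝ) / 2) *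
      ‖∫ ξ in Ω, (Circle.exp (inner ℝ x ξ + t * ‖ξ‖ ^ 2) : ℂ)‖ := by
  rw [schrodinger, norm_mul, Complex.norm_real, Real.norm_of_nonneg (by positivity),
    ← integral_indicator hΩ]
  congr 2
  refine integral_congr_ae ?_
  filter_upwards [hf] with ξ hξ
  rw [hξ, mul_comm Complex.I, ← Circle.coe_exp]
  by_cases h : ξ ∈ Ω <;> simp [h]

end IndicatorData

theorem lintegral_enorm_hat_le {f : L2 n} (hf : FourierSupportedInUnitBall f) :
    ∫⁻ ξ, ‖hat f ξ‖ₑ ≤ ‖f‖ₑ * volume (Metric.ball (0 : Rn n) 1) ^ (1 / 2 : ℝ) := by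
  set B : Set (Rn n) := Metric.ball 0 1
  calc ∫⁻ ξ, ‖hat f ξ‖ₑ = ∫⁻ ξ, B.indicator (fun ξ => ‖hat f ξ‖ₑ) ξ := by
        refine lintegral_congr_ae ?_
        filter_upwards [hf] with ξ hξ
        by_cases h : ξ ∈ B
        · rw [Set.indicator_of_mem h]
        · rw [Set.indicator_of_notMem h, hξ h, enorm_zero]
    _ = eLpNorm (hat f) 1 (volume.restrict B) := by
        rw [lintegral_indicator measurableSet_ball, eLpNorm_one_eq_lintegral_enorm]
    _ ≤ eLpNorm (hat f) 2 (volume.restrict B) * volume B ^ (1 / 2 : ℝ) := by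
        have h := eLpNorm_le_eLpNorm_mul_rpow_measure_univ (μ := volume.restrict B)
          (p := 1) (q := 2) one_le_two (aestronglyMeasurable_hat f).restrict
        rw [Measure.restrict_apply_univ] at h
        norm_num at h ⊢
        exact h
    _ ≤ ‖f‖ₑ * volume B ^ (1 / 2 : ℝ) := by
        gcongr
        exact (eLpNorm_mono_measure (hat f) Measure.restrict_le_self).trans_eq (eLpNorm_hat f)

theorem enorm_schrodinger_le {f : L2 n} (hf : FourierSupportedInUnitBall f) (t : ℝ) (x : Rn n) :
    ‖schrodinger t f x‖ₑ ≤ ENNReal.ofReal ((2 * Real.pi) ^ (-(n : ℝ) / 2)) *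
      (‖f‖ₑ * volume (Metric.ball (0 : Rn n) 1) ^ (1 / 2 : ℝ)) := by
  rw [schrodinger, enorm_mul, ← ofReal_norm, Complex.norm_real, Real.norm_of_nonneg (by positivity)]
  gcongr
  refine (enorm_integral_le_lintegral_enorm _).trans
    (le_of_eq_of_le (lintegral_congr fun ξ => ?_) (lintegral_enorm_hat_le hf))
  rw [enorm_mul, mul_comm Complex.I, ← Circle.coe_exp, ← ofReal_norm (E := ℂ) (Circle.exp _),
    Circle.norm_coe, ENNReal.ofReal_one, one_mul]

end FourierSide

theorem exists_isAdmissible (n : ℕ) (p : ℝ≥0∞) : ∃ γ : ℝ, IsAdmissible n p γ := by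
  set V : ℝ := volume.real (Metric.ball (0 : Rn n) 1)
  have hV_nonneg : 0 ≤ V := measureReal_nonneg
  set A : ℝ := (2 * Real.pi) ^ (-(n : ℝ) / 2) * V ^ (1 / 2 : ℝ) with hA
  have hV_eq : volume (Metric.ball (0 : Rn n) 1) = ENNReal.ofReal V :=
    (ofReal_measureReal measure_ball_lt_top.ne).symm
  refine ⟨n * p.toReal⁻¹, fun ε hε => ⟨A * V ^ p.toReal⁻¹ + 1, by positivity,
    fun R hR f hf => ?_⟩⟩
  have hR_pos : 0 < R := by linarith
  have hmax (x : Rn n) : maximalFunction R f x ≤ ENNReal.ofReal (A * ‖f‖) := by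
    refine iSup₂_le fun t _ => (enorm_schrodinger_le hf t x).trans_eq ?_
    rw [hV_eq, ENNReal.ofReal_rpow_of_nonneg hV_nonneg (by norm_num), ← ofReal_norm,
      ← ENNReal.ofReal_mul (by positivity), ← ENNReal.ofReal_mul (by positivity), hA]
    ring_nf
  have hball : volume (Metric.ball (0 : Rn n) R) = ENNReal.ofReal (R ^ n * V) := by
    rw [Measure.addHaar_ball_of_pos _ _ hR_pos, hV_eq, ← ENNReal.ofReal_mul (by positivity),
      finrank_euclideanSpace_fin]
  calc eLpNorm (maximalFunction R f) p (volume.restrict (Metric.ball (0 : Rn n) R))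
      ≤ ENNReal.ofReal (A * ‖f‖) * ENNReal.ofReal (R ^ n * V) ^ p.toReal⁻¹ := by
        rw [← hball, ← Measure.restrict_apply_univ (Metric.ball (0 : Rn n) R)]
        exact eLpNorm_le_of_ae_enorm_bound (Filter.Eventually.of_forall hmax)
    _ = ENNReal.ofReal (A * V ^ p.toReal⁻¹ * R ^ ((n : ℝ) * p.toReal⁻¹) * ‖f‖) := by
        rw [ENNReal.ofReal_rpow_of_nonneg (by positivity) (by positivity),
          ← ENNReal.ofReal_mul (by positivity), Real.mul_rpow (by positivity) hV_nonneg,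
          ← Real.rpow_natCast, ← Real.rpow_mul hR_pos.le]
        ring_nf
    _ ≤ ENNReal.ofReal ((A * V ^ p.toReal⁻¹ + 1) * R ^ ε * R ^ ((n : ℝ) * p.toReal⁻¹) * ‖f‖) := by
        have hRε : 1 ≤ R ^ ε := Real.one_le_rpow hR.le hε.le
        gcongr ENNReal.ofReal (?_ * _ * _)
        calc A * V ^ p.toReal⁻¹ = A * V ^ p.toReal⁻¹ * 1 := (mul_one _).symm
          _ ≤ (A * V ^ p.toReal⁻¹ + 1) * R ^ ε := by gcongr; linarith

section Box

variable {n : ℕ}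

/-- The product set `∏ A i` in `ℝⁿ`. -/
def box (A : Fin n → Set ℝ) : Set (Rn n) := {ξ | ∀ i, ξ i ∈ A i}

variable {A : Fin n → Set ℝ}

theorem toLp_preimage_box (A : Fin n → Set ℝ) :
    (WithLp.toLp 2 : (Fin n → ℝ) → Rn n) ⁻¹' box A = Set.univ.pi A := by
  ext y
  simp [box]

theorem measurableSet_box (hA : ∀ i, MeasurableSet (A i)) : MeasurableSet (box A) := by
  simp only [box, Set.ofPred_forall]
  exact MeasurableSet.iInter fun i => (hA i).preimage (by fun_prop)

theorem volume_preimage_toLp {S : Set (Rn n)} (hS : MeasurableSet S) :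
    volume ((WithLp.toLp 2 : (Fin n → ℝ) → Rn n) ⁻¹' S) = volume S :=
  (PiLp.volume_preserving_toLp (Fin n)).measure_preimage hS.nullMeasurableSet

theorem volume_box (hA : ∀ i, MeasurableSet (A i)) : volume (box A) = ∏ i, volume (A i) := by
  rw [← volume_preimage_toLp (measurableSet_box hA), toLp_preimage_box, volume_pi_pi]

theorem exp_inner_add_eq_prod (x ξ : Rn n) (t : ℝ) :
    (Circle.exp (inner ℝ x ξ + t * ‖ξ‖ ^ 2) : ℂ) = ∏ i, osc (x i) t (ξ i) := by
  simp only [osc, Circle.coe_exp]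
  rw [← Complex.exp_sum, ← Finset.sum_mul, ← Complex.ofReal_sum, EuclideanSpace.real_norm_sq_eq,
    PiLp.inner_apply, Finset.sum_add_distrib, Finset.mul_sum]
  simp [mul_comm]

theorem setIntegral_box_exp_eq_prod (A : Fin n → Set ℝ) (x : Rn n) (t : ℝ) :
    ∫ ξ in box A, (Circle.exp (inner ℝ x ξ + t * ‖ξ‖ ^ 2) : ℂ) =
      ∏ i, ∫ s in A i, osc (x i) t s := by
  simp_rw [exp_inner_add_eq_prod]
  rw [← (PiLp.volume_preserving_toLp (Fin n)).setIntegral_preimage_emb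
    (MeasurableEquiv.toLp 2 (Fin n → ℝ)).measurableEmbedding, toLp_preimage_box, volume_pi,
    Measure.restrict_pi_pi]
  exact integral_fintype_prod_eq_prod fun i s => osc (x i) t s

theorem norm_le_card_mul_of_forall_abs_le {x : Rn n} {c : ℝ} (h : ∀ i, |x i| ≤ c) :
    ‖x‖ ≤ n * c := by
  calc ‖x‖ ≤ ∑ i, ‖x i‖ := by
        conv_lhs => rw [← (EuclideanSpace.basisFun (Fin n) ℝ).sum_repr x]
        simpa [norm_smul] using
          norm_sum_le Finset.univ fun i => x i • EuclideanSpace.basisFun (Fin n) ℝ i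
    _ ≤ ∑ _i : Fin n, c := Finset.sum_le_sum fun i _ => h i
    _ = n * c := by simp

end Box

theorem prod_ite_val_lt {α : Type*} [CommMonoid α] {N d : ℕ} (hd : d ≤ N) (a b : α) :
    ∏ i : Fin N, (if (i : ℕ) < d then a else b) = a ^ d * b ^ (N - d) := by
  obtain ⟨k, rfl⟩ := Nat.exists_eq_add_of_le hd
  simp [Fin.prod_univ_add]

theorem pow_mul_pow_le_prod {N d : ℕ} (hd : d ≤ N) {a b : ℝ} (ha : 0 ≤ a) (hb : 0 ≤ b)
    {F : Fin N → ℝ} (h : ∀ i : Fin N, (if (i : ℕ) < d then a else b) ≤ F i) :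
    a ^ d * b ^ (N - d) ≤ ∏ i, F i := by
  rw [← prod_ite_val_lt hd]
  refine Finset.prod_le_prod (fun i _ => ?_) fun i _ => h i
  split_ifs <;> assumption

theorem volume_iUnion_ball {ι : Type*} (B : Finset ι) {c : ι → ℝ} {ρ : ℝ}
    (hc : Pairwise fun i j => 2 * ρ ≤ dist (c i) (c j)) :
    volume (⋃ b ∈ B, Metric.ball (c b) ρ) = ENNReal.ofReal (B.card * (2 * ρ)) := by
  rw [measure_biUnion_finset (fun i _ j _ hij => Metric.ball_disjoint_ball
    ((two_mul ρ).symm.le.trans (hc hij))) fun _ _ => measurableSet_ball]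
  simp [Real.volume_ball, ENNReal.ofReal_mul]

theorem mul_le_volume_of_le_volume_section {N : ℕ} {S : Set (Fin (N + 1) → ℝ)}
    (hS : MeasurableSet S) {G : Set (Fin N → ℝ)} (hG : MeasurableSet G) {v : ℝ≥0∞}
    (h : ∀ z ∈ G, v ≤ volume {s : ℝ | Fin.cons s z ∈ S}) : v * volume G ≤ volume S := by
  set e := MeasurableEquiv.piFinSuccAbove (fun _ : Fin (N + 1) => ℝ) 0
  have hmp : MeasurePreserving e.symm :=
    (volume_preserving_piFinSuccAbove (fun _ : Fin (N + 1) => ℝ) 0).symm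
  have hsection (z : Fin N → ℝ) :
      (fun s => (s, z)) ⁻¹' (e.symm ⁻¹' S) = {s : ℝ | Fin.cons s z ∈ S} := by
    ext s
    change Fin.insertNth 0 s z ∈ S ↔ Fin.cons s z ∈ S
    rw [Fin.insertNth_zero']
  calc v * volume G = ∫⁻ _ in G, v := (setLIntegral_const G v).symm
    _ ≤ ∫⁻ z in G, volume {s : ℝ | Fin.cons s z ∈ S} := setLIntegral_mono' hG h
    _ ≤ ∫⁻ z, volume {s : ℝ | Fin.cons s z ∈ S} := setLIntegral_le_lintegral G _
    _ = volume (e.symm ⁻¹' S) := by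
        simp_rw [Measure.volume_eq_prod ℝ, Measure.prod_apply_symm (hS.preimage hmp.measurable),
          hsection]
    _ = volume S := hmp.measure_preimage hS.nullMeasurableSet

theorem mul_volume_rpow_le_eLpNorm {X : Type*} [MeasurableSpace X] {μ : Measure X} {p : ℝ≥0∞}
    (hp : p ≠ 0) {F : X → ℝ≥0∞} {S : Set X} (hS : MeasurableSet S) (hS_ne : μ S ≠ 0) {v : ℝ≥0∞}
    (h : ∀ x ∈ S, v ≤ F x) : v * μ S ^ (p⁻¹).toReal ≤ eLpNorm F p μ := by
  calc v * μ S ^ (p⁻¹).toReal = eLpNorm (S.indicator fun _ => v) p μ := by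
        rw [eLpNorm_indicator_const' hS hS_ne hp, enorm_eq_self, one_div, ENNReal.toReal_inv]
    _ ≤ eLpNorm F p μ := by
        refine eLpNorm_mono_enorm fun x => ?_
        rw [enorm_eq_self, enorm_eq_self]
        exact Set.indicator_le h x

section Dirichlet

/-- The points `x` of `(0, T]` for which `x / r` is within `1 / (q K)` of a fraction with
denominator `q`. -/
def nearRational (r T : ℝ) (K q : ℕ) : Set ℝ :=
  {x | x ∈ Set.Ioc 0 T ∧ ∃ a : ℤ, |q * (x / r) - a| ≤ 1 / K}

theorem measurableSet_nearRational (r T : ℝ) (K q : ℕ) : MeasurableSet (nearRational r T K q) := by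
  have h : nearRational r T K q = Set.Ioc 0 T ∩ ⋃ a : ℤ, {x : ℝ | |q * (x / r) - a| ≤ 1 / K} := by
    ext x
    simp [nearRational]
  rw [h]
  exact measurableSet_Ioc.inter (MeasurableSet.iUnion fun a =>
    (isClosed_le (by fun_prop) (by fun_prop)).measurableSet)

theorem nearRational_subset_biUnion_closedBall {r T : ℝ} (hr : 0 < r) {K q : ℕ} (hK : 2 ≤ K)
    (hq : 0 < q) :
    nearRational r T K q ⊆ ⋃ a ∈ Finset.range ⌈q * (T / r) + 1⌉₊,
      Metric.closedBall (r * a / q) (r / (q * K)) := by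
  rintro x ⟨⟨hx_pos, hx_le⟩, a, ha⟩
  have hK' : (2 : ℝ) ≤ K := by exact_mod_cast hK
  have hinv : (1 : ℝ) / K < 1 := by
    rw [div_lt_one (by positivity)]
    linarith
  obtain ⟨ha_lower, ha_upper⟩ := abs_le.1 ha
  have ha_nonneg : 0 ≤ a := by
    have h : (-1 : ℝ) < a := by linarith [show 0 ≤ q * (x / r) by positivity]
    have h' : -1 < a := by exact_mod_cast h
    lia
  lift a to ℕ using ha_nonneg
  rw [Int.cast_natCast] at *
  refine Set.mem_biUnion (x := a) (Finset.mem_coe.2 (Finset.mem_range.2 (Nat.lt_ceil.2 ?_))) ?_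
  · have h : q * (x / r) ≤ q * (T / r) := by gcongr
    linarith
  · have hdist : x - r * a / q = r / q * (q * (x / r) - a) := by field_simp
    rw [Metric.mem_closedBall, Real.dist_eq, hdist, abs_mul, abs_of_pos (by positivity)]
    calc r / q * |q * (x / r) - a| ≤ r / q * (1 / K) := by gcongr
      _ = r / (q * K) := by field_simp

theorem volume_nearRational_le {r T : ℝ} (hr : 0 < r) (hrT : r ≤ T) {K q : ℕ} (hK : 2 ≤ K)
    (hq : 0 < q) : volume (nearRational r T K q) ≤ ENNReal.ofReal (6 * T / K) := by
  have hT : 0 < T := hr.trans_le hrT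
  have hone : 1 ≤ q * (T / r) :=
    one_le_mul_of_one_le_of_one_le (by exact_mod_cast hq) ((one_le_div hr).2 hrT)
  have hcount : (⌈q * (T / r) + 1⌉₊ : ℝ) ≤ 3 * (q * (T / r)) := by
    linarith [Nat.ceil_lt_add_one (show 0 ≤ q * (T / r) + 1 by positivity)]
  refine (measure_mono (nearRational_subset_biUnion_closedBall hr hK hq)).trans
    ((measure_biUnion_finset_le _ _).trans ?_)
  simp_rw [Real.volume_closedBall]
  rw [Finset.sum_const, Finset.card_range, nsmul_eq_mul, ← ENNReal.ofReal_natCast,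
    ← ENNReal.ofReal_mul (by positivity)]
  refine ENNReal.ofReal_le_ofReal ?_
  calc (⌈q * (T / r) + 1⌉₊ : ℝ) * (2 * (r / (q * K)))
      ≤ 3 * (q * (T / r)) * (2 * (r / (q * K))) := by gcongr
    _ = 6 * T / K := by field_simp; ring

/-- The sides of the product set of those points in `(0, T]^d × (0, s]^(N - d)` whose first `d`
coordinates are simultaneously close to fractions with denominator `q`. -/
def tailSide (N d : ℕ) (r T s : ℝ) (K q : ℕ) (i : Fin N) : Set ℝ :=
  if (i : ℕ) < d then nearRational r T K q else Set.Ioc 0 s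

/-- The denominators supplied by Dirichlet's theorem, without the small ones: these only account
for a small proportion of all points. -/
def denominators (d K : ℕ) : Finset ℕ :=
  Finset.Ioc (K ^ d / (2 * 6 ^ d)) (K ^ d)

theorem measurableSet_tailSide (N d : ℕ) (r T s : ℝ) (K q : ℕ) (i : Fin N) :
    MeasurableSet (tailSide N d r T s K q i) := by
  unfold tailSide
  split_ifs
  · exact measurableSet_nearRational r T K q
  · exact measurableSet_Ioc

theorem measurableSet_iUnion_pi_tailSide (N d : ℕ) (r T s : ℝ) (K : ℕ) (B : Finset ℕ) :
    MeasurableSet (⋃ q ∈ B, Set.univ.pi (tailSide N d r T s K q)) :=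
  Finset.measurableSet_biUnion _ fun q _ =>
    MeasurableSet.univ_pi (measurableSet_tailSide N d r T s K q)

variable {N d K : ℕ} {r T s : ℝ}

theorem pi_subset_iUnion_pi_tailSide (hd : d ≤ N) (hK : 0 < K) :
    Set.univ.pi (fun i : Fin N => if (i : ℕ) < d then Set.Ioc 0 T else Set.Ioc 0 s) ⊆
      (⋃ q ∈ denominators d K, Set.univ.pi (tailSide N d r T s K q)) ∪
        ⋃ q ∈ Finset.Ioc 0 (K ^ d / (2 * 6 ^ d)), Set.univ.pi (tailSide N d r T s K q) := by
  intro z hz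
  obtain ⟨q, hq_pos, hq_le, happrox⟩ :=
    exists_simultaneous_approx (fun j : Fin d => z (Fin.castLE hd j) / r) hK
  rw [Fintype.card_fin] at hq_le
  have hmem : z ∈ Set.univ.pi (tailSide N d r T s K q) := by
    intro i _
    have hi := hz i trivial
    unfold tailSide
    split_ifs with h
    · simp only [h, if_true] at hi
      exact ⟨hi, happrox ⟨i, h⟩⟩
    · simpa only [h, if_false] using hi
  rcases le_or_gt q (K ^ d / (2 * 6 ^ d)) with hsmall | hlarge
  · exact Or.inr (Set.mem_biUnion (Finset.mem_coe.2 (Finset.mem_Ioc.2 ⟨hq_pos, hsmall⟩)) hmem)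
  · exact Or.inl (Set.mem_biUnion (Finset.mem_coe.2 (Finset.mem_Ioc.2 ⟨hlarge, hq_le⟩)) hmem)

theorem volume_pi_ite_val_lt (hd : d ≤ N) (hT : 0 ≤ T) (hs : 0 ≤ s) :
    volume (Set.univ.pi fun i : Fin N => if (i : ℕ) < d then Set.Ioc 0 T else Set.Ioc 0 s) =
      ENNReal.ofReal (T ^ d * s ^ (N - d)) := by
  rw [volume_pi_pi]
  simp_rw [apply_ite volume, Real.volume_Ioc, sub_zero]
  rw [prod_ite_val_lt hd, ENNReal.ofReal_mul (by positivity), ENNReal.ofReal_pow hT,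
    ENNReal.ofReal_pow hs]

theorem volume_pi_tailSide_le (hd : d ≤ N) (hK : 2 ≤ K) (hr : 0 < r) (hrT : r ≤ T) (hs : 0 ≤ s)
    {q : ℕ} (hq : 0 < q) :
    volume (Set.univ.pi (tailSide N d r T s K q)) ≤
      ENNReal.ofReal ((6 * T / K) ^ d * s ^ (N - d)) := by
  have hT : 0 < T := hr.trans_le hrT
  rw [volume_pi_pi, ENNReal.ofReal_mul (by positivity), ENNReal.ofReal_pow (by positivity),
    ENNReal.ofReal_pow hs, ← prod_ite_val_lt hd]
  refine Finset.prod_le_prod' fun i _ => ?_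
  unfold tailSide
  split_ifs
  · exact volume_nearRational_le hr hrT hK hq
  · rw [Real.volume_Ioc, sub_zero]

theorem volume_iUnion_pi_tailSide_le_half (hd : d ≤ N) (hK : 2 ≤ K) (hr : 0 < r) (hrT : r ≤ T)
    (hs : 0 ≤ s) :
    volume (⋃ q ∈ Finset.Ioc 0 (K ^ d / (2 * 6 ^ d)), Set.univ.pi (tailSide N d r T s K q)) ≤
      ENNReal.ofReal (T ^ d * s ^ (N - d) / 2) := by
  set q₀ := K ^ d / (2 * 6 ^ d)
  have hT : 0 < T := hr.trans_le hrT
  have hKd : (0 : ℝ) < (K : ℝ) ^ d := by positivity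
  have hq₀_le : (q₀ : ℝ) * (2 * 6 ^ d) ≤ K ^ d := by
    exact_mod_cast Nat.div_mul_le_self (K ^ d) (2 * 6 ^ d)
  refine (measure_biUnion_finset_le _ _).trans ((Finset.sum_le_sum fun q hq =>
    volume_pi_tailSide_le hd hK hr hrT hs (Finset.mem_Ioc.1 hq).1).trans ?_)
  rw [Finset.sum_const, Nat.card_Ioc, Nat.sub_zero, nsmul_eq_mul, ← ENNReal.ofReal_natCast,
    ← ENNReal.ofReal_mul (by positivity)]
  refine ENNReal.ofReal_le_ofReal ?_
  calc (q₀ : ℝ) * ((6 * T / K) ^ d * s ^ (N - d))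
      = (q₀ * (2 * 6 ^ d)) * ((K : ℝ) ^ d)⁻¹ * (T ^ d * s ^ (N - d) / 2) := by
        rw [div_pow, mul_pow]
        field_simp
    _ ≤ K ^ d * ((K : ℝ) ^ d)⁻¹ * (T ^ d * s ^ (N - d) / 2) := by gcongr
    _ = T ^ d * s ^ (N - d) / 2 := by rw [mul_inv_cancel₀ hKd.ne', one_mul]

theorem half_le_volume_iUnion_pi_tailSide (hd : d ≤ N) (hK : 2 ≤ K) (hr : 0 < r) (hrT : r ≤ T)
    (hs : 0 ≤ s) :
    ENNReal.ofReal (T ^ d * s ^ (N - d) / 2) ≤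
      volume (⋃ q ∈ denominators d K, Set.univ.pi (tailSide N d r T s K q)) := by
  have hT : 0 < T := hr.trans_le hrT
  have hcover := (measure_mono (pi_subset_iUnion_pi_tailSide (r := r) (T := T) (s := s) hd
    (by lia : 0 < K))).trans (measure_union_le (μ := volume) _ _)
  rw [volume_pi_ite_val_lt hd hT.le hs, ← add_halves (T ^ d * s ^ (N - d)),
    ENNReal.ofReal_add (by positivity) (by positivity)] at hcover
  exact ENNReal.le_of_add_le_add_right ENNReal.ofReal_ne_top
    (hcover.trans (by gcongr; exact volume_iUnion_pi_tailSide_le_half hd hK hr hrT hs))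

variable {q : ℕ}

theorem pos_of_mem_denominators (hq : q ∈ denominators d K) : 0 < q :=
  (Nat.zero_le _).trans_lt (Finset.mem_Ioc.1 hq).1

theorem le_pow_of_mem_denominators (hq : q ∈ denominators d K) : (q : ℝ) ≤ (K : ℝ) ^ d := by
  exact_mod_cast (Finset.mem_Ioc.1 hq).2

theorem pow_le_mul_of_mem_denominators (hq : q ∈ denominators d K) :
    (K : ℝ) ^ d ≤ 2 * 6 ^ d * q := by
  have h := (Nat.div_lt_iff_lt_mul (by positivity)).1 (Finset.mem_Ioc.1 hq).1
  rw [mul_comm]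
  exact_mod_cast h.le

theorem log_le_of_mem_denominators (hq : q ∈ denominators d K) :
    Real.log q ≤ d * Real.log K := by
  rw [← Real.log_pow]
  exact Real.log_le_log (by exact_mod_cast pos_of_mem_denominators hq)
    (le_pow_of_mem_denominators hq)

end Dirichlet

section Focusing

/-- `1` for even `q` and `2` for odd `q`, so that `parityFactor q * b * q` is always even. -/
def parityFactor (q : ℕ) : ℕ := if Even q then 1 else 2

theorem parityFactor_pos (q : ℕ) : 0 < parityFactor q := by
  unfold parityFactor
  split_ifs <;> norm_num

theorem parityFactor_le_two (q : ℕ) : parityFactor q ≤ 2 := by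
  unfold parityFactor
  split_ifs <;> norm_num

theorem even_parityFactor_mul (q b : ℕ) : Even (((parityFactor q * b : ℕ) : ℤ) * (q : ℤ)) := by
  rw [← Nat.cast_mul, Int.even_coe_nat]
  unfold parityFactor
  split_ifs with h
  · exact h.mul_left _
  · exact (even_two.mul_right b).mul_right q

theorem isCoprime_parityFactor_mul {q b : ℕ} (h : q.Coprime b) :
    IsCoprime ((parityFactor q * b : ℕ) : ℤ) (q : ℤ) := by
  rw [Nat.isCoprime_iff_coprime]
  refine Nat.Coprime.mul_left ?_ h.symm
  unfold parityFactor
  split_ifs with hq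
  · exact Nat.coprime_one_left q
  · exact Nat.coprime_two_left.2 (Nat.not_even_iff_odd.1 hq)

/-- The smallness of `κ` and the largeness of `K` on which the example depends: `κ` is the implied
constant of all its scales, which are powers of `K`. -/
structure ScaleBounds (N d : ℕ) (κ : ℝ) (K : ℕ) : Prop where
  pos : 0 < κ
  small : κ * ((N + 1) * 6 ^ d) ≤ 1 / 100
  large : 16 * (1 + d * Real.log K) ≤ κ * K

namespace ScaleBounds

variable {N d K : ℕ} {κ : ℝ}

theorem mul_six_pow_le (hs : ScaleBounds N d κ K) : κ * 6 ^ d ≤ 1 / 100 := by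
  refine le_trans ?_ hs.small
  have hκ := hs.pos
  gcongr
  exact le_mul_of_one_le_left (by positivity) (by simp)

theorem mul_card_le (hs : ScaleBounds N d κ K) : κ * (N + 1) ≤ 1 / 100 := by
  refine le_trans ?_ hs.small
  have hκ := hs.pos
  gcongr
  exact le_mul_of_one_le_right (by positivity) (one_le_pow₀ (by norm_num))

theorem le_one_div_hundred (hs : ScaleBounds N d κ K) : κ ≤ 1 / 100 :=
  (le_mul_of_one_le_right hs.pos.le (one_le_pow₀ (by norm_num))).trans hs.mul_six_pow_le

theorem sixteen_le_mul (hs : ScaleBounds N d κ K) : 16 ≤ κ * K := by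
  have hlog : 0 ≤ d * Real.log K := mul_nonneg d.cast_nonneg (Real.log_natCast_nonneg K)
  linarith [hs.large]

theorem sixteen_hundred_le (hs : ScaleBounds N d κ K) : (1600 : ℝ) ≤ K := by
  have h : κ * K ≤ 1 / 100 * K := by
    gcongr
    exact hs.le_one_div_hundred
  linarith [hs.sixteen_le_mul]

theorem one_le (hs : ScaleBounds N d κ K) : (1 : ℝ) ≤ K :=
  le_trans (by norm_num) hs.sixteen_hundred_le

theorem natCast_pos (hs : ScaleBounds N d κ K) : (0 : ℝ) < K :=
  one_pos.trans_le hs.one_le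

theorem two_le (hs : ScaleBounds N d κ K) : 2 ≤ K := by
  have h : (2 : ℝ) ≤ K := le_trans (by norm_num) hs.sixteen_hundred_le
  exact_mod_cast h

theorem one_le_mul_pow (hs : ScaleBounds N d κ K) {j : ℕ} (hj : j ≠ 0) : 1 ≤ κ * (K : ℝ) ^ j := by
  have hκ := hs.pos
  calc (1 : ℝ) ≤ κ * K := le_trans (by norm_num) hs.sixteen_le_mul
    _ ≤ κ * (K : ℝ) ^ j := by gcongr; exact le_self_pow₀ hs.one_le hj

theorem pow_mul_log_le (hs : ScaleBounds N d κ K) {q : ℕ} (hq : q ∈ denominators d K) :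
    q * (2 * (1 + Real.log q)) ≤ (⌊κ * (K : ℝ) ^ (d + 1)⌋₊ : ℝ) / 4 := by
  have hfloor := Nat.div_two_lt_floor (hs.one_le_mul_pow d.succ_ne_zero)
  calc q * (2 * (1 + Real.log q)) ≤ (K : ℝ) ^ d * (2 * (1 + d * Real.log K)) := by
        gcongr
        · exact le_pow_of_mem_denominators hq
        · exact log_le_of_mem_denominators hq
    _ ≤ (K : ℝ) ^ d * (κ * K / 8) := by gcongr; linarith [hs.large]
    _ = κ * (K : ℝ) ^ (d + 1) / 2 / 4 := by ring
    _ ≤ (⌊κ * (K : ℝ) ^ (d + 1)⌋₊ : ℝ) / 4 := by gcongr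

end ScaleBounds

theorem half_le_norm_setIntegral_wavePacket {κ ρ c x t : ℝ} (hκ : 0 ≤ κ) (hκ_le : κ ≤ 1 / 2)
    (hρ : 0 < ρ) (ht : 0 ≤ t) (htρ : t ≤ ρ ^ 2) (hx : |x + 2 * c * t| ≤ ρ) :
    κ / ρ / 2 ≤ ‖∫ ξ in Set.Ioc c (c + κ / ρ), osc x t ξ‖ := by
  refine half_le_norm_setIntegral_Ioc_osc (by positivity) fun u ⟨hu, hu_le⟩ => ?_
  calc |x * u + t * (2 * c * u + u ^ 2)| = |(x + 2 * c * t) * u + t * u ^ 2| := by ring_nf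
    _ ≤ |x + 2 * c * t| * u + t * u ^ 2 := by
        refine (abs_add_le _ _).trans_eq ?_
        rw [abs_mul, abs_of_nonneg hu, abs_of_nonneg (by positivity : 0 ≤ t * u ^ 2)]
    _ ≤ ρ * (κ / ρ) + ρ ^ 2 * (κ / ρ) ^ 2 := by gcongr
    _ = κ + κ ^ 2 := by field_simp
    _ ≤ 1 := by nlinarith

/-- The comb of the example, whose teeth are so thin that the phase hardly varies on each of them
for times up to `R = K ^ (2 d + 4)`. -/
def freqComb (κ : ℝ) (d K : ℕ) : Set ℝ :=
  comb (1 / (K : ℝ) ^ (d + 1)) (κ / (K : ℝ) ^ (2 * d + 4)) ⌊κ * (K : ℝ) ^ (d + 1)⌋₊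

variable {N d K q : ℕ} {κ x t u : ℝ} {a b : ℤ}

theorem ScaleBounds.toothWidth_le (hs : ScaleBounds N d κ K) :
    κ / (K : ℝ) ^ (2 * d + 4) ≤ 1 / (K : ℝ) ^ (d + 1) := by
  have hK := hs.natCast_pos
  gcongr ?_ / ?_
  · linarith [hs.le_one_div_hundred]
  · exact pow_le_pow_right₀ hs.one_le (by lia)

theorem ScaleBounds.abs_phaseSlope_le (hs : ScaleBounds N d κ K) (hq : q ∈ denominators d K)
    (ha : |q * (x / (2 * Real.pi * (K : ℝ) ^ (d + 1))) - a| ≤ 1 / K)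
    (ht : 0 ≤ t) (ht_le : t ≤ (K : ℝ) ^ (2 * d + 4))
    (hu : u ∈ Set.Icc 0 (κ / (K : ℝ) ^ (2 * d + 4))) :
    |x / (K : ℝ) ^ (d + 1) - 2 * Real.pi * a / q + 2 * t * (1 / (K : ℝ) ^ (d + 1)) * u| ≤
      9 / (q * K) := by
  have hK := hs.natCast_pos
  have hκ := hs.pos
  have hu_nonneg := hu.1
  have hq_pos : (0 : ℝ) < q := by exact_mod_cast pos_of_mem_denominators hq
  have hβ : |x / (K : ℝ) ^ (d + 1) - 2 * Real.pi * a / q| ≤ 8 / (q * K) :=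
    calc |x / (K : ℝ) ^ (d + 1) - 2 * Real.pi * a / q|
        = |2 * Real.pi / q * (q * (x / (2 * Real.pi * (K : ℝ) ^ (d + 1))) - a)| := by
          congr 1
          field_simp
      _ ≤ 2 * 4 / q * (1 / K) := by
          rw [abs_mul, abs_of_pos (by positivity)]
          gcongr
          exact Real.pi_le_four
      _ = 8 / (q * K) := by field_simp; norm_num
  have hdrift : 2 * t * (1 / (K : ℝ) ^ (d + 1)) * u ≤ 1 / (q * K) :=
    calc 2 * t * (1 / (K : ℝ) ^ (d + 1)) * u
        ≤ 2 * (K : ℝ) ^ (2 * d + 4) * (1 / (K : ℝ) ^ (d + 1)) * (κ / (K : ℝ) ^ (2 * d + 4)) := by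
          gcongr
          exact hu.2
      _ = 2 * κ / ((K : ℝ) ^ d * K) := by field_simp; ring
      _ ≤ 1 / (q * K) := by
          gcongr
          · linarith [hs.le_one_div_hundred]
          · exact le_pow_of_mem_denominators hq
  refine (abs_add_le _ _).trans ?_
  rw [abs_of_nonneg (by positivity : 0 ≤ 2 * t * (1 / (K : ℝ) ^ (d + 1)) * u)]
  linarith [show (9 : ℝ) / (q * K) = 8 / (q * K) + 1 / (q * K) by ring]

theorem ScaleBounds.abs_phase_le_one (hs : ScaleBounds N d κ K) (hq : q ∈ denominators d K)
    (hx : 0 ≤ x) (hx_le : x ≤ κ * (K : ℝ) ^ (2 * d + 4))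
    (ht : 0 ≤ t) (ht_le : t ≤ (K : ℝ) ^ (2 * d + 4))
    (hu : u ∈ Set.Icc 0 (κ / (K : ℝ) ^ (2 * d + 4))) {θ : ℝ} (hθ : |θ| ≤ 9 / (q * K)) {ℓ : ℕ}
    (hℓ : ℓ < ⌊κ * (K : ℝ) ^ (d + 1)⌋₊) : |x * u + t * u ^ 2 + θ * ℓ| ≤ 1 := by
  have hK := hs.natCast_pos
  have hκ := hs.pos
  have hκ_le := hs.le_one_div_hundred
  obtain ⟨hu_nonneg, hu_le⟩ := hu
  have hq_pos : (0 : ℝ) < q := by exact_mod_cast pos_of_mem_denominators hq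
  have hlinear : x * u ≤ κ ^ 2 :=
    calc x * u ≤ κ * (K : ℝ) ^ (2 * d + 4) * (κ / (K : ℝ) ^ (2 * d + 4)) := by gcongr
      _ = κ ^ 2 := by field_simp
  have hquadratic : t * u ^ 2 ≤ κ ^ 2 :=
    calc t * u ^ 2 ≤ (K : ℝ) ^ (2 * d + 4) * (κ / (K : ℝ) ^ (2 * d + 4)) ^ 2 := by gcongr
      _ = κ ^ 2 / (K : ℝ) ^ (2 * d + 4) := by field_simp
      _ ≤ κ ^ 2 := div_le_self (by positivity) (one_le_pow₀ hs.one_le)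
  have hℓ_le : (ℓ : ℝ) ≤ κ * (K * (2 * 6 ^ d * q)) :=
    calc (ℓ : ℝ) ≤ κ * (K : ℝ) ^ (d + 1) := (Nat.le_floor_iff (by positivity)).1 hℓ.le
      _ = κ * (K * (K : ℝ) ^ d) := by ring
      _ ≤ κ * (K * (2 * 6 ^ d * q)) := by gcongr; exact pow_le_mul_of_mem_denominators hq
  have htooth : |θ * ℓ| ≤ 18 / 100 :=
    calc |θ * ℓ| = |θ| * ℓ := by rw [abs_mul, Nat.abs_cast]
      _ ≤ 9 / (q * K) * (κ * (K * (2 * 6 ^ d * q))) := by gcongr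
      _ = 18 * (κ * 6 ^ d) := by field_simp; norm_num
      _ ≤ 18 / 100 := by linarith [hs.mul_six_pow_le]
  calc |x * u + t * u ^ 2 + θ * ℓ| ≤ (x * u + t * u ^ 2) + |θ * ℓ| := by
        refine (abs_add_le _ _).trans_eq ?_
        rw [abs_of_nonneg (by positivity)]
    _ ≤ 1 := by nlinarith

theorem le_norm_setIntegral_freqComb (hs : ScaleBounds N d κ K) (hq : q ∈ denominators d K)
    (hx : x ∈ nearRational (2 * Real.pi * (K : ℝ) ^ (d + 1)) (κ * (K : ℝ) ^ (2 * d + 4)) K q)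
    (hb : Even (b * q)) (hbq : IsCoprime b (q : ℤ))
    (htb : t * (1 / (K : ℝ) ^ (d + 1)) ^ 2 = Real.pi * b / q)
    (ht : 0 ≤ t) (ht_le : t ≤ (K : ℝ) ^ (2 * d + 4)) :
    ⌊κ * (K : ℝ) ^ (d + 1)⌋₊ * (κ / (K : ℝ) ^ (2 * d + 4)) * (√((K : ℝ) ^ d))⁻¹ / 4 ≤
      ‖∫ ξ in freqComb κ d K, osc x t ξ‖ := by
  obtain ⟨⟨hx_pos, hx_le⟩, a, ha⟩ := hx
  have hK := hs.natCast_pos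
  have hκ := hs.pos
  have hq_pos := pos_of_mem_denominators hq
  set L := ⌊κ * (K : ℝ) ^ (d + 1)⌋₊
  set w := κ / (K : ℝ) ^ (2 * d + 4)
  have hslope {u : ℝ} (hu : u ∈ Set.Icc 0 w) := hs.abs_phaseSlope_le hq ha ht ht_le hu
  calc L * w * (√((K : ℝ) ^ d))⁻¹ / 4 = w * (√((K : ℝ) ^ d))⁻¹ * (L / 2 - L / 4) := by ring
    _ ≤ w * (√q)⁻¹ * (L / 2 - q * (2 * (1 + Real.log q))) := by
        have hlog := hs.pow_mul_log_le hq
        gcongr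
        · linarith [L.cast_nonneg (α := ℝ)]
        · exact le_pow_of_mem_denominators hq
    _ ≤ ‖∫ ξ in freqComb κ d K, osc x t ξ‖ := by
        refine le_norm_setIntegral_comb_osc (by positivity) hs.toothWidth_le hq_pos hb hbq htb
          (a := a) (by ring) (fun u hu => (hslope hu).trans ?_)
          fun u hu ℓ hℓ => hs.abs_phase_le_one hq hx_pos.le hx_le ht ht_le hu (hslope hu) hℓ
        rw [div_mul_eq_div_div_swap]
        gcongr
        rw [div_le_iff₀ hK]
        nlinarith [Real.pi_gt_three, hs.sixteen_hundred_le]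

end Focusing

section Example

/-- The time `t` with `t σ ^ 2 = π * (parityFactor q * b) / q` for the spacing
`σ = 1 / K ^ (d + 1)` of the combs, at which they produce quadratic Gauss sums modulo `q`. -/
noncomputable def focusTime (K d q b : ℕ) : ℝ :=
  Real.pi * (parityFactor q * b : ℕ) / q * (K : ℝ) ^ (2 * d + 2)

/-- The first coordinates that the wave packet at frequency `κ` reaches at a time
`focusTime K d q b` with `b` prime to `q`. -/
def headSide (κ : ℝ) (K d q : ℕ) : Set ℝ :=
  ⋃ b ∈ (Finset.Ico 1 (1 + q * ⌊κ * (K : ℝ) ^ 2⌋₊)).filter q.Coprime,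
    Metric.ball (-(2 * κ * focusTime K d q b)) (κ * (K : ℝ) ^ (d + 2))

/-- The set on which the maximal function of the example is large. -/
def largeSet (κ : ℝ) (N d K : ℕ) : Set (Rn (N + 1)) :=
  ⋃ q ∈ denominators d K, box (Fin.cons (headSide κ K d q)
    (tailSide N d (2 * Real.pi * (K : ℝ) ^ (d + 1)) (κ * (K : ℝ) ^ (2 * d + 4))
      ((K : ℝ) ^ (d + 2)) K q))

/-- The sides of the frequency support of the example: the wave packet in the first coordinate,
combs in the next `d` coordinates, and intervals in the others. -/
def freqSide (κ : ℝ) (N d K : ℕ) : Fin (N + 1) → Set ℝ :=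
  Fin.cons (Set.Ioc κ (κ + κ / (K : ℝ) ^ (d + 2))) fun i : Fin N =>
    if (i : ℕ) < d then freqComb κ d K else Set.Ioc 0 (0 + κ / (K : ℝ) ^ (d + 2))

variable {N d K q b : ℕ} {κ y t : ℝ} {x : Rn (N + 1)}

theorem focusTime_mul_sq (hK : 0 < K) (q b : ℕ) :
    focusTime K d q b * (1 / (K : ℝ) ^ (d + 1)) ^ 2 =
      Real.pi * ((parityFactor q * b : ℕ) : ℤ) / q := by
  rw [focusTime, Int.cast_natCast]
  field_simp
  ring

theorem focusTime_pos (hK : 0 < K) (hq : 0 < q) (hb : 0 < b) : 0 < focusTime K d q b := by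
  have hfactor := parityFactor_pos q
  unfold focusTime
  positivity

theorem focusTime_le (hκ : 0 ≤ κ) (hq : 0 < q) (hb : b ≤ q * ⌊κ * (K : ℝ) ^ 2⌋₊) :
    focusTime K d q b ≤ 8 * κ * (K : ℝ) ^ (2 * d + 4) := by
  have hb' : (b : ℝ) ≤ q * (κ * (K : ℝ) ^ 2) :=
    calc (b : ℝ) ≤ q * (⌊κ * (K : ℝ) ^ 2⌋₊ : ℝ) := by exact_mod_cast hb
      _ ≤ q * (κ * (K : ℝ) ^ 2) := by gcongr; exact Nat.floor_le (by positivity)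
  unfold focusTime
  push_cast
  calc Real.pi * (parityFactor q * b) / q * (K : ℝ) ^ (2 * d + 2)
      ≤ 4 * (2 * (q * (κ * (K : ℝ) ^ 2))) / q * (K : ℝ) ^ (2 * d + 2) := by
        gcongr
        · exact Real.pi_le_four
        · exact_mod_cast parityFactor_le_two q
    _ = 8 * κ * (K : ℝ) ^ (2 * d + 4) := by field_simp; ring

theorem ScaleBounds.exists_focusTime_of_mem_headSide (hs : ScaleBounds N d κ K) (hq : 0 < q)
    (hy : y ∈ headSide κ K d q) :
    ∃ b, q.Coprime b ∧ 0 < focusTime K d q b ∧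
      focusTime K d q b ≤ 8 * κ * (K : ℝ) ^ (2 * d + 4) ∧
      |y + 2 * κ * focusTime K d q b| ≤ κ * (K : ℝ) ^ (d + 2) := by
  simp only [headSide, Set.mem_iUnion, Finset.mem_filter, Finset.mem_Ico, Metric.mem_ball,
    Real.dist_eq, sub_neg_eq_add, exists_prop] at hy
  obtain ⟨b, ⟨⟨hb_pos, hb_lt⟩, hcoprime⟩, hdist⟩ := hy
  exact ⟨b, hcoprime, focusTime_pos (by linarith [hs.two_le]) hq hb_pos,
    focusTime_le hs.pos.le hq (by lia), hdist.le⟩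

theorem two_mul_le_dist_focusTime (hκ : 0 ≤ κ) (hK : 0 < K) (hq : q ∈ denominators d K) :
    Pairwise fun b b' : ℕ => 2 * (κ * (K : ℝ) ^ (d + 2)) ≤
      dist (-(2 * κ * focusTime K d q b)) (-(2 * κ * focusTime K d q b')) := by
  intro b b' hne
  have hq_pos : (0 : ℝ) < q := by exact_mod_cast pos_of_mem_denominators hq
  have hpi : 1 ≤ Real.pi := by linarith [Real.pi_gt_three]
  have hfactor : (1 : ℝ) ≤ parityFactor q := by exact_mod_cast parityFactor_pos q
  have hdist : (1 : ℝ) ≤ |(b : ℝ) - b'| := by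
    exact_mod_cast Int.one_le_abs (sub_ne_zero.2 (Nat.cast_injective.ne hne))
  calc 2 * (κ * (K : ℝ) ^ (d + 2))
      = 2 * κ * (1 * (1 * 1) / (K : ℝ) ^ d * (K : ℝ) ^ (2 * d + 2)) := by field_simp; ring
    _ ≤ 2 * κ * (Real.pi * (parityFactor q * |(b : ℝ) - b'|) / q * (K : ℝ) ^ (2 * d + 2)) := by
        gcongr
        exact le_pow_of_mem_denominators hq
    _ = |2 * κ * (Real.pi * parityFactor q / q * (K : ℝ) ^ (2 * d + 2)) * (b - b')| := by
        rw [abs_mul, abs_of_nonneg (a := 2 * κ * _) (by positivity)]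
        ring
    _ = dist (-(2 * κ * focusTime K d q b)) (-(2 * κ * focusTime K d q b')) := by
        rw [dist_neg_neg, Real.dist_eq, focusTime, focusTime]
        push_cast
        ring_nf

theorem ScaleBounds.le_volume_headSide (hs : ScaleBounds N d κ K) (hq : q ∈ denominators d K) :
    ENNReal.ofReal (κ ^ 2 / (2 * 6 ^ d) * (K : ℝ) ^ (2 * d + 4) / (1 + 2 * (d * Real.log K))) ≤
      volume (headSide κ K d q) := by
  have hκ := hs.pos
  have hK := hs.natCast_pos
  have hq_pos := pos_of_mem_denominators hq
  have hfloor := Nat.div_two_lt_floor (hs.one_le_mul_pow two_ne_zero)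
  have htotient : (K : ℝ) ^ d / (2 * 6 ^ d) / (1 + 2 * (d * Real.log K)) ≤ q.totient :=
    calc (K : ℝ) ^ d / (2 * 6 ^ d) / (1 + 2 * (d * Real.log K)) ≤ q / (1 + 2 * Real.log q) := by
          gcongr
          · rw [div_le_iff₀ (by positivity), mul_comm]
            exact pow_le_mul_of_mem_denominators hq
          · exact log_le_of_mem_denominators hq
      _ ≤ q.totient := div_one_add_two_mul_log_le_totient hq_pos
  rw [headSide, volume_iUnion_ball _ (two_mul_le_dist_focusTime hκ.le (by linarith [hs.two_le]) hq),
    card_filter_coprime_Ico_mul]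
  refine ENNReal.ofReal_le_ofReal ?_
  push_cast
  calc κ ^ 2 / (2 * 6 ^ d) * (K : ℝ) ^ (2 * d + 4) / (1 + 2 * (d * Real.log K))
      = κ * (K : ℝ) ^ 2 / 2 * ((K : ℝ) ^ d / (2 * 6 ^ d) / (1 + 2 * (d * Real.log K))) *
          (2 * (κ * (K : ℝ) ^ (d + 2))) := by ring
    _ ≤ ⌊κ * (K : ℝ) ^ 2⌋₊ * q.totient * (2 * (κ * (K : ℝ) ^ (d + 2))) := by gcongr

theorem mem_largeSet_iff :
    x ∈ largeSet κ N d K ↔ ∃ q ∈ denominators d K, x 0 ∈ headSide κ K d q ∧ ∀ i : Fin N,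
      x i.succ ∈ tailSide N d (2 * Real.pi * (K : ℝ) ^ (d + 1)) (κ * (K : ℝ) ^ (2 * d + 4))
        ((K : ℝ) ^ (d + 2)) K q i := by
  simp [largeSet, box, Fin.forall_fin_succ, and_left_comm]

theorem measurableSet_largeSet (κ : ℝ) (N d K : ℕ) : MeasurableSet (largeSet κ N d K) := by
  refine Finset.measurableSet_biUnion _ fun q _ => measurableSet_box (Fin.cases ?_ fun i => ?_)
  · exact Finset.measurableSet_biUnion _ fun _ _ => measurableSet_ball
  · exact measurableSet_tailSide ..

theorem ScaleBounds.two_pi_mul_pow_le (hs : ScaleBounds N d κ K) :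
    2 * Real.pi * (K : ℝ) ^ (d + 1) ≤ κ * (K : ℝ) ^ (2 * d + 4) := by
  have hK := hs.natCast_pos
  calc 2 * Real.pi * (K : ℝ) ^ (d + 1) ≤ 2 * 4 * (K : ℝ) ^ (d + 1) := by
        gcongr
        exact Real.pi_le_four
    _ ≤ (κ * K) * (K : ℝ) ^ (2 * d + 3) :=
        mul_le_mul (by linarith [hs.sixteen_le_mul]) (pow_le_pow_right₀ hs.one_le (by lia))
          (by positivity) (by linarith [hs.sixteen_le_mul])
    _ = κ * (K : ℝ) ^ (2 * d + 4) := by ring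

theorem ScaleBounds.le_volume_largeSet (hs : ScaleBounds N d κ K) (hd : d ≤ N) :
    ENNReal.ofReal (κ ^ 2 / (2 * 6 ^ d) * κ ^ d / 2 *
      (K : ℝ) ^ ((2 * d + 4) * (d + 1) + (d + 2) * (N - d)) / (1 + 2 * (d * Real.log K))) ≤
      volume (largeSet κ N d K) := by
  have hκ := hs.pos
  have hK := hs.natCast_pos
  set T := κ * (K : ℝ) ^ (2 * d + 4)
  set v := κ ^ 2 / (2 * 6 ^ d) * (K : ℝ) ^ (2 * d + 4) / (1 + 2 * (d * Real.log K))
  set G := ⋃ q ∈ denominators d K, Set.univ.pi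
    (tailSide N d (2 * Real.pi * (K : ℝ) ^ (d + 1)) T ((K : ℝ) ^ (d + 2)) K q)
  have hsection : ∀ z ∈ G, ENNReal.ofReal v ≤
      volume {y : ℝ | Fin.cons y z ∈ WithLp.toLp 2 ⁻¹' largeSet κ N d K} := by
    intro z hz
    simp only [G, Set.mem_iUnion, Set.mem_univ_pi] at hz
    obtain ⟨q, hq, hz⟩ := hz
    exact (hs.le_volume_headSide hq).trans
      (measure_mono fun y hy => mem_largeSet_iff.2 ⟨q, hq, hy, hz⟩)
  calc _ = ENNReal.ofReal v * ENNReal.ofReal (T ^ d * ((K : ℝ) ^ (d + 2)) ^ (N - d) / 2) := by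
        rw [← ENNReal.ofReal_mul (by positivity)]
        congr 1
        rw [mul_pow κ]
        ring
    _ ≤ ENNReal.ofReal v * volume G := by
        gcongr
        exact half_le_volume_iUnion_pi_tailSide hd hs.two_le (by positivity) hs.two_pi_mul_pow_le
          (by positivity)
    _ ≤ volume (WithLp.toLp 2 ⁻¹' largeSet κ N d K) :=
        mul_le_volume_of_le_volume_section
          ((PiLp.volume_preserving_toLp (Fin (N + 1))).measurable (measurableSet_largeSet κ N d K))
          (measurableSet_iUnion_pi_tailSide ..) hsection
    _ = volume (largeSet κ N d K) := volume_preimage_toLp (measurableSet_largeSet κ N d K)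

theorem ScaleBounds.pow_le_mul_pow (hs : ScaleBounds N d κ K) :
    (K : ℝ) ^ (d + 2) ≤ κ * (K : ℝ) ^ (2 * d + 4) := by
  have hK := hs.natCast_pos
  calc (K : ℝ) ^ (d + 2) = 1 * (K : ℝ) ^ (d + 2) := (one_mul _).symm
    _ ≤ κ * (K : ℝ) ^ (d + 2) * (K : ℝ) ^ (d + 2) := by
        gcongr
        exact hs.one_le_mul_pow (by lia)
    _ = κ * (K : ℝ) ^ (2 * d + 4) := by ring

theorem ScaleBounds.abs_le_of_mem_largeSet (hs : ScaleBounds N d κ K) (hx : x ∈ largeSet κ N d K)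
    (i : Fin (N + 1)) : |x i| ≤ 2 * κ * (K : ℝ) ^ (2 * d + 4) := by
  have hκ := hs.pos
  have hK := hs.natCast_pos
  have hR : 0 < κ * (K : ℝ) ^ (2 * d + 4) := by positivity
  obtain ⟨q, hq, hhead, htail⟩ := mem_largeSet_iff.1 hx
  refine Fin.cases ?_ (fun i => ?_) i
  · obtain ⟨b, -, ht, ht_le, hdist⟩ :=
      hs.exists_focusTime_of_mem_headSide (pos_of_mem_denominators hq) hhead
    have hradius : κ * (K : ℝ) ^ (d + 2) ≤ κ * (K : ℝ) ^ (2 * d + 4) :=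
      mul_le_mul_of_nonneg_left (pow_le_pow_right₀ hs.one_le (by lia)) hκ.le
    calc |x 0| = |(x 0 + 2 * κ * focusTime K d q b) - 2 * κ * focusTime K d q b| := by ring_nf
      _ ≤ κ * (K : ℝ) ^ (2 * d + 4) + 2 * (1 / 100) * (8 * κ * (K : ℝ) ^ (2 * d + 4)) := by
          refine (abs_sub _ _).trans (add_le_add (hdist.trans hradius) ?_)
          rw [abs_of_pos (by positivity)]
          gcongr
          exact hs.le_one_div_hundred
      _ ≤ 2 * κ * (K : ℝ) ^ (2 * d + 4) := by linarith
  · have hi := htail i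
    unfold tailSide at hi
    split_ifs at hi
    · rw [abs_of_pos hi.1.1]
      linarith [hi.1.2]
    · rw [abs_of_pos hi.1]
      linarith [hi.2, hs.pow_le_mul_pow]

theorem ScaleBounds.largeSet_subset_ball (hs : ScaleBounds N d κ K) :
    largeSet κ N d K ⊆ Metric.ball 0 ((K : ℝ) ^ (2 * d + 4)) := by
  intro x hx
  have hR : 0 < (K : ℝ) ^ (2 * d + 4) := pow_pos hs.natCast_pos _
  rw [mem_ball_zero_iff]
  calc ‖x‖ ≤ (N + 1 : ℕ) * (2 * κ * (K : ℝ) ^ (2 * d + 4)) :=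
        norm_le_card_mul_of_forall_abs_le (hs.abs_le_of_mem_largeSet hx)
    _ = 2 * (κ * (N + 1)) * (K : ℝ) ^ (2 * d + 4) := by push_cast; ring
    _ < 1 * (K : ℝ) ^ (2 * d + 4) := by
        gcongr
        linarith [hs.mul_card_le]
    _ = (K : ℝ) ^ (2 * d + 4) := one_mul _

end Example

section Extremal

variable {N d K : ℕ} {κ : ℝ} {x : Rn (N + 1)}

theorem measurableSet_freqSide (κ : ℝ) (N d K : ℕ) (i : Fin (N + 1)) :
    MeasurableSet (freqSide κ N d K i) := by
  refine Fin.cases measurableSet_Ioc (fun i => ?_) i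
  simp only [freqSide, Fin.cons_succ]
  split_ifs
  · exact measurableSet_comb _ _ _
  · exact measurableSet_Ioc

theorem ScaleBounds.volume_box_freqSide (hs : ScaleBounds N d κ K) (hd : d ≤ N) :
    volume (box (freqSide κ N d K)) = ENNReal.ofReal (κ / (K : ℝ) ^ (d + 2) *
      ((⌊κ * (K : ℝ) ^ (d + 1)⌋₊ * (κ / (K : ℝ) ^ (2 * d + 4))) ^ d *
        (κ / (K : ℝ) ^ (d + 2)) ^ (N - d))) := by
  have hκ := hs.pos
  rw [volume_box (measurableSet_freqSide κ N d K), Fin.prod_univ_succ]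
  simp only [freqSide, Fin.cons_zero, Fin.cons_succ, apply_ite volume]
  rw [freqComb, volume_comb (by positivity) hs.toothWidth_le, prod_ite_val_lt hd, Real.volume_Ioc,
    Real.volume_Ioc, add_sub_cancel_left, add_sub_cancel_left, ← ENNReal.ofReal_pow (by positivity),
    ← ENNReal.ofReal_pow (by positivity), ← ENNReal.ofReal_mul (by positivity),
    ← ENNReal.ofReal_mul (by positivity)]

theorem ScaleBounds.le_volume_box_freqSide (hs : ScaleBounds N d κ K) (hd : d ≤ N) :
    κ ^ (N - d + 1) * (κ ^ 2 / 2) ^ d * ((K : ℝ) ^ ((d + 2) * (N - d + 1) + (d + 3) * d))⁻¹ ≤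
      volume.real (box (freqSide κ N d K)) := by
  have hκ := hs.pos
  have hK := hs.natCast_pos
  have hcomb : κ ^ 2 / 2 / (K : ℝ) ^ (d + 3) ≤
      ⌊κ * (K : ℝ) ^ (d + 1)⌋₊ * (κ / (K : ℝ) ^ (2 * d + 4)) :=
    calc κ ^ 2 / 2 / (K : ℝ) ^ (d + 3)
        = κ * (K : ℝ) ^ (d + 1) / 2 * (κ / (K : ℝ) ^ (2 * d + 4)) := by
          field_simp
          ring
      _ ≤ _ := by
          gcongr
          exact (Nat.div_two_lt_floor (hs.one_le_mul_pow d.succ_ne_zero)).le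
  rw [measureReal_def, hs.volume_box_freqSide hd, ENNReal.toReal_ofReal (by positivity)]
  calc _ = κ / (K : ℝ) ^ (d + 2) *
        ((κ ^ 2 / 2 / (K : ℝ) ^ (d + 3)) ^ d * (κ / (K : ℝ) ^ (d + 2)) ^ (N - d)) := by
        rw [div_pow (κ ^ 2 / 2), div_pow κ, ← pow_mul, ← pow_mul, pow_succ κ, pow_add, mul_add_one,
          pow_add]
        field_simp
    _ ≤ _ := by gcongr

theorem ScaleBounds.abs_le_of_mem_freqComb (hs : ScaleBounds N d κ K) {ξ : ℝ}
    (hξ : ξ ∈ freqComb κ d K) : |ξ| ≤ κ := by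
  have hκ := hs.pos
  have hK := hs.natCast_pos
  simp only [freqComb, comb, Set.mem_iUnion, Set.mem_Ioc, Finset.mem_range, exists_prop] at hξ
  obtain ⟨ℓ, hℓ, hξ_gt, hξ_le⟩ := hξ
  have hξ_pos : 0 < ξ := lt_of_le_of_lt (by positivity) hξ_gt
  have hℓ' : (ℓ : ℝ) + 1 ≤ κ * (K : ℝ) ^ (d + 1) := by
    refine le_trans ?_ (Nat.floor_le (by positivity))
    exact_mod_cast hℓ
  rw [abs_of_pos hξ_pos]
  calc ξ ≤ 1 / (K : ℝ) ^ (d + 1) * (ℓ + 1) := by linarith [hs.toothWidth_le]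
    _ ≤ 1 / (K : ℝ) ^ (d + 1) * (κ * (K : ℝ) ^ (d + 1)) := by gcongr
    _ = κ := by field_simp

theorem ScaleBounds.box_freqSide_subset_ball (hs : ScaleBounds N d κ K) :
    box (freqSide κ N d K) ⊆ Metric.ball 0 1 := by
  have hκ := hs.pos
  have hpacket : κ / (K : ℝ) ^ (d + 2) ≤ κ := div_le_self hκ.le (one_le_pow₀ hs.one_le)
  intro ξ hξ
  have hcoord (i : Fin (N + 1)) : |ξ i| ≤ 2 * κ := by
    have hi := hξ i
    revert hi
    refine Fin.cases ?_ (fun i => ?_) i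
    · simp only [freqSide, Fin.cons_zero]
      rintro ⟨hi_gt, hi_le⟩
      rw [abs_of_pos (hκ.trans hi_gt)]
      linarith
    · simp only [freqSide, Fin.cons_succ]
      split_ifs
      · intro hi
        linarith [hs.abs_le_of_mem_freqComb hi]
      · rintro ⟨hi_gt, hi_le⟩
        rw [abs_of_pos hi_gt]
        linarith
  rw [mem_ball_zero_iff]
  calc ‖ξ‖ ≤ (N + 1 : ℕ) * (2 * κ) := norm_le_card_mul_of_forall_abs_le hcoord
    _ = 2 * (κ * (N + 1)) := by push_cast; ring
    _ < 1 := by linarith [hs.mul_card_le]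

theorem ScaleBounds.exists_time_forall_le_norm_setIntegral (hs : ScaleBounds N d κ K)
    (hx : x ∈ largeSet κ N d K) :
    ∃ t ∈ Set.Ioc (0 : ℝ) ((K : ℝ) ^ (2 * d + 4)),
      κ / (K : ℝ) ^ (d + 2) / 4 ≤ ‖∫ ξ in freqSide κ N d K 0, osc (x 0) t ξ‖ ∧
      ∀ i : Fin N, (if (i : ℕ) < d then
          ⌊κ * (K : ℝ) ^ (d + 1)⌋₊ * (κ / (K : ℝ) ^ (2 * d + 4)) * (√((K : ℝ) ^ d))⁻¹ / 4
        else κ / (K : ℝ) ^ (d + 2) / 4) ≤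
          ‖∫ ξ in freqSide κ N d K i.succ, osc (x i.succ) t ξ‖ := by
  have hκ := hs.pos
  have hκ_le := hs.le_one_div_hundred
  have hK := hs.natCast_pos
  obtain ⟨q, hq, hhead, htail⟩ := mem_largeSet_iff.1 hx
  obtain ⟨b, hcoprime, ht, ht_le, hdist⟩ :=
    hs.exists_focusTime_of_mem_headSide (pos_of_mem_denominators hq) hhead
  have htR : focusTime K d q b ≤ (K : ℝ) ^ (2 * d + 4) :=
    ht_le.trans (mul_le_of_le_one_left (by positivity) (by linarith))
  have hpacket {c y : ℝ} (hy : |y + 2 * c * focusTime K d q b| ≤ (K : ℝ) ^ (d + 2)) :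
      κ / (K : ℝ) ^ (d + 2) / 4 ≤
        ‖∫ ξ in Set.Ioc c (c + κ / (K : ℝ) ^ (d + 2)), osc y (focusTime K d q b) ξ‖ := by
    refine le_trans ?_ (half_le_norm_setIntegral_wavePacket hκ.le (by linarith) (by positivity)
      ht.le (htR.trans_eq (by ring)) hy)
    gcongr
    norm_num
  refine ⟨focusTime K d q b, ⟨ht, htR⟩, hpacket (hdist.trans ?_), fun i => ?_⟩
  · exact mul_le_of_le_one_left (by positivity) (by linarith)
  · have hi := htail i
    simp only [freqSide, Fin.cons_succ]
    unfold tailSide at hi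
    split_ifs at hi ⊢
    · exact le_norm_setIntegral_freqComb hs hq hi (even_parityFactor_mul q b)
        (isCoprime_parityFactor_mul hcoprime)
        (focusTime_mul_sq (by linarith [hs.two_le]) q b) ht.le htR
    · refine hpacket ?_
      rw [mul_zero, zero_mul, add_zero, abs_of_pos hi.1]
      exact hi.2

theorem ScaleBounds.exists_time_le_norm_setIntegral (hs : ScaleBounds N d κ K) (hd : d ≤ N)
    (hx : x ∈ largeSet κ N d K) :
    ∃ t ∈ Set.Ioc (0 : ℝ) ((K : ℝ) ^ (2 * d + 4)),
      volume.real (box (freqSide κ N d K)) * ((1 / 4) ^ (N + 1) * (√((K : ℝ) ^ d))⁻¹ ^ d) ≤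
        ‖∫ ξ in box (freqSide κ N d K), (Circle.exp (inner ℝ x ξ + t * ‖ξ‖ ^ 2) : ℂ)‖ := by
  have hκ := hs.pos
  obtain ⟨t, ht, hhead, htail⟩ := hs.exists_time_forall_le_norm_setIntegral hx
  refine ⟨t, ht, ?_⟩
  rw [setIntegral_box_exp_eq_prod, norm_prod, Fin.prod_univ_succ, measureReal_def,
    hs.volume_box_freqSide hd, ENNReal.toReal_ofReal (by positivity)]
  set δ := κ / (K : ℝ) ^ (d + 2)
  set S := (√((K : ℝ) ^ d))⁻¹
  set D := ⌊κ * (K : ℝ) ^ (d + 1)⌋₊ * (κ / (K : ℝ) ^ (2 * d + 4))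
  have hquarter : (1 / 4 : ℝ) ^ (N + 1) = 1 / 4 * ((1 / 4) ^ d * (1 / 4) ^ (N - d)) := by
    rw [← pow_add, pow_succ', Nat.add_sub_cancel' hd]
  calc δ * (D ^ d * δ ^ (N - d)) * ((1 / 4) ^ (N + 1) * S ^ d)
      = δ / 4 * ((D * S / 4) ^ d * (δ / 4) ^ (N - d)) := by
        rw [hquarter, div_eq_mul_one_div (D * S), div_eq_mul_one_div δ, mul_pow (D * S), mul_pow D,
          mul_pow δ]
        ring
    _ ≤ _ := by
        gcongr
        exact pow_mul_pow_le_prod hd (by positivity) (by positivity) htail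

end Extremal

section Asymptotics

theorem eventually_one_add_mul_log_le (a : ℝ) {c η : ℝ} (hc : 0 < c) (hη : 0 < η) :
    ∀ᶠ K : ℕ in Filter.atTop, 1 + a * Real.log K ≤ c * (K : ℝ) ^ η := by
  have hone : (fun _ : ℝ => (1 : ℝ)) =o[Filter.atTop] fun x => x ^ η :=
    Asymptotics.isLittleO_const_left.2
      (Or.inr (tendsto_norm_atTop_atTop.comp (tendsto_rpow_atTop hη)))
  have hbound := (hone.add ((isLittleO_log_rpow_atTop hη).const_mul_left a)).bound hc
  filter_upwards [tendsto_natCast_atTop_atTop.eventually hbound] with K hK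
  rw [Real.norm_of_nonneg (by positivity : 0 ≤ (K : ℝ) ^ η)] at hK
  exact (Real.le_norm_self _).trans hK

theorem le_of_eventually_mul_rpow_le {c C α β : ℝ} (hc : 0 < c)
    (h : ∀ᶠ K : ℕ in Filter.atTop, c * (K : ℝ) ^ α ≤ C * (K : ℝ) ^ β) : α ≤ β := by
  by_contra! hlt
  have hlarge := ((tendsto_rpow_atTop (sub_pos.2 hlt)).comp
    tendsto_natCast_atTop_atTop).eventually_gt_atTop (C / c)
  obtain ⟨K, hK, hK_large, hK_pos⟩ :=
    (h.and (hlarge.and (Filter.eventually_gt_atTop 0))).exists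
  have hK_pos' : (0 : ℝ) < K := by exact_mod_cast hK_pos
  simp only [Function.comp_apply] at hK_large
  rw [Real.rpow_sub hK_pos', div_lt_div_iff₀ hc (by positivity)] at hK_large
  linarith

theorem eventually_scaleBounds (N d : ℕ) {κ : ℝ} (hκ : 0 < κ)
    (hsmall : κ * ((N + 1) * 6 ^ d) ≤ 1 / 100) :
    ∀ᶠ K : ℕ in Filter.atTop, ScaleBounds N d κ K := by
  filter_upwards [eventually_one_add_mul_log_le d (c := κ / 16) (by positivity) one_pos]
    with K hK
  rw [Real.rpow_one] at hK
  exact ⟨hκ, hsmall, by linarith⟩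

end Asymptotics

section Test

variable {n : ℕ}

/-- A test for the maximal estimate at scale `R`: a nonzero `f` with Fourier support in the unit
ball whose maximal function is at least `Λ * ‖f‖` on a set `S` of measure at least `V` in the ball
of radius `R`. -/
structure IsExtremalPair (f : L2 n) (S : Set (Rn n)) (R V Λ : ℝ) : Prop where
  fourierSupported : FourierSupportedInUnitBall f
  norm_pos : 0 < ‖f‖
  measurableSet : MeasurableSet S
  subset_ball : S ⊆ Metric.ball 0 R
  le_volume : ENNReal.ofReal V ≤ volume S
  le_maximalFunction : ∀ x ∈ S, ENNReal.ofReal (Λ * ‖f‖) ≤ maximalFunction R f x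

theorem IsExtremalPair.mul_rpow_le {f : L2 n} {S : Set (Rn n)} {R V Λ B : ℝ} {p : ℝ≥0∞}
    (h : IsExtremalPair f S R V Λ) (hV : 0 < V) (hΛ : 0 ≤ Λ) (hB : 0 ≤ B) (hp : p ≠ 0)
    (hbound : eLpNorm (maximalFunction R f) p (volume.restrict (Metric.ball 0 R)) ≤
      ENNReal.ofReal (B * ‖f‖)) : Λ * V ^ (p⁻¹).toReal ≤ B := by
  have hvol : ENNReal.ofReal V ≤ volume.restrict (Metric.ball 0 R) S := by
    rw [Measure.restrict_apply h.measurableSet, Set.inter_eq_left.2 h.subset_ball]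
    exact h.le_volume
  have hmain : ENNReal.ofReal (Λ * ‖f‖ * V ^ (p⁻¹).toReal) ≤ ENNReal.ofReal (B * ‖f‖) :=
    calc ENNReal.ofReal (Λ * ‖f‖ * V ^ (p⁻¹).toReal)
        = ENNReal.ofReal (Λ * ‖f‖) * ENNReal.ofReal V ^ (p⁻¹).toReal := by
          rw [ENNReal.ofReal_mul (by positivity), ENNReal.ofReal_rpow_of_pos hV]
      _ ≤ ENNReal.ofReal (Λ * ‖f‖) *
          volume.restrict (Metric.ball 0 R) S ^ (p⁻¹).toReal := by gcongr
      _ ≤ eLpNorm (maximalFunction R f) p (volume.restrict (Metric.ball 0 R)) :=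
          mul_volume_rpow_le_eLpNorm hp h.measurableSet
            ((ENNReal.ofReal_pos.2 hV).trans_le hvol).ne' h.le_maximalFunction
      _ ≤ ENNReal.ofReal (B * ‖f‖) := hbound
  rw [ENNReal.ofReal_le_ofReal_iff (mul_nonneg hB (norm_nonneg f)), mul_right_comm] at hmain
  exact le_of_mul_le_mul_right hmain h.norm_pos

theorem IsAdmissible.le_mul_of_eventually_isExtremalPair {p : ℝ≥0∞} {γ a b v e : ℝ} {ρ : ℕ}
    (hγ : IsAdmissible n p γ) (hp : p ≠ 0) (hρ : ρ ≠ 0) (ha : 0 < a) (hb : 0 < b)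
    (h : ∀ᶠ K : ℕ in Filter.atTop, ∃ (f : L2 n) (S : Set (Rn n)),
      IsExtremalPair f S ((K : ℝ) ^ ρ) (a * (K : ℝ) ^ v) (b * (K : ℝ) ^ (-e))) :
    v * (p⁻¹).toReal - e ≤ ρ * γ := by
  refine le_of_forall_pos_le_add fun ε hε => ?_
  have hρ' : (0 : ℝ) < ρ := by exact_mod_cast hρ.bot_lt
  obtain ⟨C, hC, hadm⟩ := hγ (ε / ρ) (by positivity)
  refine le_of_eventually_mul_rpow_le (c := b * a ^ (p⁻¹).toReal) (C := C) (by positivity) ?_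
  filter_upwards [h, Filter.eventually_gt_atTop 1] with K ⟨f, S, hpair⟩ hK
  have hK' : (1 : ℝ) < K := by exact_mod_cast hK
  have hK_pos : (0 : ℝ) < K := by linarith
  calc b * a ^ (p⁻¹).toReal * (K : ℝ) ^ (v * (p⁻¹).toReal - e)
      = b * (K : ℝ) ^ (-e) * (a * (K : ℝ) ^ v) ^ (p⁻¹).toReal := by
        rw [Real.mul_rpow ha.le (by positivity), ← Real.rpow_mul hK_pos.le, sub_eq_add_neg,
          Real.rpow_add hK_pos]
        ring
    _ ≤ C * ((K : ℝ) ^ ρ) ^ (ε / ρ) * ((K : ℝ) ^ ρ) ^ γ :=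
        hpair.mul_rpow_le (by positivity) (by positivity) (by positivity) hp
          (hadm _ (one_lt_pow₀ hK' hρ) f hpair.fourierSupported)
    _ = C * (K : ℝ) ^ (ρ * γ + ε) := by
        rw [← Real.rpow_natCast (K : ℝ) ρ, ← Real.rpow_mul hK_pos.le, ← Real.rpow_mul hK_pos.le,
          mul_div_cancel₀ _ hρ'.ne', Real.rpow_add hK_pos]
        ring

end Test

section LowerBound

variable {N d K : ℕ} {κ : ℝ}

theorem inv_sqrt_pow_eq_rpow {x : ℝ} (hx : 0 ≤ x) (s : ℕ) : (√(x ^ s))⁻¹ = x ^ (-(s / 2 : ℝ)) := by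
  rw [Real.sqrt_eq_rpow, ← Real.rpow_natCast, ← Real.rpow_mul hx, ← Real.rpow_neg hx,
    mul_one_div]

theorem ScaleBounds.le_sqrt_volume_box_freqSide (hs : ScaleBounds N d κ K) (hd : d ≤ N) :
    √(κ ^ (N - d + 1) * (κ ^ 2 / 2) ^ d) *
        (K : ℝ) ^ (-(((d + 2) * (N - d + 1) + (d + 3) * d + d * d) / 2 : ℝ)) ≤
      √(volume.real (box (freqSide κ N d K))) * (√((K : ℝ) ^ d))⁻¹ ^ d := by
  have hκ := hs.pos
  have hK := hs.natCast_pos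
  calc _ = √(κ ^ (N - d + 1) * (κ ^ 2 / 2) ^ d) *
          (√((K : ℝ) ^ ((d + 2) * (N - d + 1) + (d + 3) * d)))⁻¹ * (√((K : ℝ) ^ d))⁻¹ ^ d := by
        rw [inv_sqrt_pow_eq_rpow hK.le, inv_sqrt_pow_eq_rpow hK.le, ← Real.rpow_mul_natCast hK.le,
          mul_assoc, ← Real.rpow_add hK]
        push_cast [Nat.cast_sub hd]
        ring_nf
    _ ≤ _ := by
        rw [← Real.sqrt_inv, ← Real.sqrt_mul (by positivity)]
        gcongr
        exact hs.le_volume_box_freqSide hd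

theorem ScaleBounds.le_maximalFunction (hs : ScaleBounds N d κ K) (hd : d ≤ N) {f : L2 (N + 1)}
    (hf : hat f =ᵐ[volume] (box (freqSide κ N d K)).indicator 1) {x : Rn (N + 1)}
    (hx : x ∈ largeSet κ N d K) :
    ENNReal.ofReal ((2 * Real.pi) ^ (-((N + 1 : ℕ) : ℝ) / 2) * (1 / 4) ^ (N + 1) *
          √(κ ^ (N - d + 1) * (κ ^ 2 / 2) ^ d) *
        (K : ℝ) ^ (-(((d + 2) * (N - d + 1) + (d + 3) * d + d * d) / 2 : ℝ)) * ‖f‖) ≤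
      maximalFunction ((K : ℝ) ^ (2 * d + 4)) f x := by
  have hΩ := measurableSet_box (measurableSet_freqSide κ N d K)
  have hsqrt := hs.le_sqrt_volume_box_freqSide hd
  obtain ⟨t, ht, hlower⟩ := hs.exists_time_le_norm_setIntegral hd hx
  refine le_trans ?_ (le_iSup₂ (f := fun t _ => ‖schrodinger t f x‖ₑ) t ht)
  rw [← ofReal_norm, norm_schrodinger_of_hat_ae_eq_indicator hf hΩ]
  refine ENNReal.ofReal_le_ofReal ?_
  set Ω := box (freqSide κ N d K)
  set A := (2 * Real.pi) ^ (-((N + 1 : ℕ) : ℝ) / 2)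
  calc _ ≤ A * (1 / 4) ^ (N + 1) * (√(volume.real Ω) * (√((K : ℝ) ^ d))⁻¹ ^ d) * ‖f‖ := by
        rw [mul_assoc (A * _) (√_)]
        gcongr
    _ = A * (√(volume.real Ω) * √(volume.real Ω) *
        ((1 / 4) ^ (N + 1) * (√((K : ℝ) ^ d))⁻¹ ^ d)) := by
        rw [norm_eq_of_hat_ae_eq_indicator hf hΩ]
        ring
    _ ≤ _ := by
        rw [Real.mul_self_sqrt measureReal_nonneg]
        gcongr

theorem ScaleBounds.exists_isExtremalPair (hs : ScaleBounds N d κ K) (hd : d ≤ N) {η : ℝ}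
    (hlog : 1 + 2 * (d * Real.log K) ≤ (K : ℝ) ^ η) :
    ∃ f, IsExtremalPair f (largeSet κ N d K) ((K : ℝ) ^ (2 * d + 4))
      (κ ^ 2 / (2 * 6 ^ d) * κ ^ d / 2 *
        (K : ℝ) ^ ((2 * d + 4) * (d + 1) + (d + 2) * (N - d) - η : ℝ))
      ((2 * Real.pi) ^ (-((N + 1 : ℕ) : ℝ) / 2) * (1 / 4) ^ (N + 1) *
          √(κ ^ (N - d + 1) * (κ ^ 2 / 2) ^ d) *
        (K : ℝ) ^ (-(((d + 2) * (N - d + 1) + (d + 3) * d + d * d) / 2 : ℝ))) := by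
  have hκ := hs.pos
  have hK := hs.natCast_pos
  have hΩ := measurableSet_box (measurableSet_freqSide κ N d K)
  obtain ⟨f, hf⟩ := exists_hat_ae_eq_indicator hΩ
    ((measure_mono hs.box_freqSide_subset_ball).trans_lt measure_ball_lt_top).ne
  refine ⟨f, fourierSupportedInUnitBall_of_hat_ae_eq_indicator hf hs.box_freqSide_subset_ball,
    ?_, measurableSet_largeSet κ N d K, hs.largeSet_subset_ball,
    le_trans (ENNReal.ofReal_le_ofReal ?_) (hs.le_volume_largeSet hd),
    fun x hx => hs.le_maximalFunction hd hf hx⟩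
  · rw [norm_eq_of_hat_ae_eq_indicator hf hΩ]
    exact Real.sqrt_pos.2 (lt_of_lt_of_le (by positivity) (hs.le_volume_box_freqSide hd))
  · rw [Real.rpow_sub hK, ← mul_div_assoc]
    gcongr ?_ / ?_
    rw [← Real.rpow_natCast (K : ℝ)]
    push_cast [Nat.cast_sub hd]
    rfl

theorem IsAdmissible.mul_sub_le {p : ℝ≥0∞} {γ : ℝ} (hγ : IsAdmissible (N + 1) p γ) (hp : p ≠ 0)
    (hd : d ≤ N) :
    ((2 * d + 4) * (d + 1) + (d + 2) * (N - d) : ℝ) * (p⁻¹).toReal -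
        ((d + 2) * (N - d + 1) + (d + 3) * d + d * d) / 2 ≤ (2 * d + 4 : ℕ) * γ := by
  set κ : ℝ := 1 / 100 / ((N + 1) * 6 ^ d)
  have hκ : 0 < κ := by positivity
  have hscale := eventually_scaleBounds N d hκ (div_mul_cancel₀ _ (by positivity)).le
  have htest (η : ℝ) (hη : 0 < η) :
      ((2 * d + 4) * (d + 1) + (d + 2) * (N - d) - η : ℝ) * (p⁻¹).toReal -
        ((d + 2) * (N - d + 1) + (d + 3) * d + d * d) / 2 ≤ (2 * d + 4 : ℕ) * γ := by
    refine hγ.le_mul_of_eventually_isExtremalPair hp (by lia)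
      (a := κ ^ 2 / (2 * 6 ^ d) * κ ^ d / 2)
      (b := (2 * Real.pi) ^ (-((N + 1 : ℕ) : ℝ) / 2) * (1 / 4) ^ (N + 1) *
        √(κ ^ (N - d + 1) * (κ ^ 2 / 2) ^ d)) (by positivity) (by positivity) ?_
    filter_upwards [hscale, eventually_one_add_mul_log_le (2 * d) one_pos hη] with K hs hlog
    rw [one_mul, mul_assoc] at hlog
    obtain ⟨f, hf⟩ := hs.exists_isExtremalPair hd hlog
    exact ⟨f, _, hf⟩
  refine le_of_forall_pos_le_add fun ε hε => ?_
  have hloss : ε / ((p⁻¹).toReal + 1) * (p⁻¹).toReal ≤ ε := by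
    rw [div_mul_eq_mul_div, div_le_iff₀ (by positivity)]
    linarith
  linarith [htest (ε / ((p⁻¹).toReal + 1)) (by positivity)]

theorem IsAdmissible.lowerBound_le {p : ℝ≥0∞} {γ : ℝ} (hγ : IsAdmissible (N + 1) p γ) (hp : p ≠ 0)
    (hd : d ≤ N) :
    ((N + 1 : ℕ) + (d + 1 : ℕ) : ℝ) / 2 * ((p⁻¹).toReal - 1 / 2) +
      (d + 1 : ℕ) / (2 * ((d + 1 : ℕ) + 1)) ≤ γ := by
  have hscale : (0 : ℝ) < (2 * d + 4 : ℕ) := by positivity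
  refine le_of_mul_le_mul_left (le_of_eq_of_le ?_ (hγ.mul_sub_le hp hd)) hscale
  push_cast
  field_simp
  ring

end LowerBound

end SchrodingerMaximal

theorem theorem1p1_general {n m : ℕ} (hm : 1 ≤ m) (hmn : m ≤ n) {p : ℝ≥0∞} (hp : p ≠ 0) :
    IsGLB {γ : ℝ | SchrodingerMaximal.IsAdmissible n p γ}
        (SchrodingerMaximal.optimalExponent n p) ∧
      ((n : ℝ) + m) / 2 * ((p⁻¹).toReal - 1 / 2) + (m : ℝ) / (2 * ((m : ℝ) + 1)) ≤
        SchrodingerMaximal.optimalExponent n p := by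
  have hne := SchrodingerMaximal.exists_isAdmissible n p
  have hlb : ((n : ℝ) + m) / 2 * ((p⁻¹).toReal - 1 / 2) + (m : ℝ) / (2 * ((m : ℝ) + 1)) ∈
      lowerBounds {γ : ℝ | SchrodingerMaximal.IsAdmissible n p γ} := by
    intro γ hγ
    obtain ⟨N, rfl⟩ := Nat.exists_eq_add_of_le' (hm.trans hmn)
    obtain ⟨d, rfl⟩ := Nat.exists_eq_add_of_le' hm
    exact hγ.lowerBound_le hp (by lia)
  exact ⟨isGLB_csInf hne ⟨_, hlb⟩, le_csInf hne hlb⟩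

/-- The first conjunct says that the optimal exponent is a genuine infimum (the set of admissible
exponents is non-empty and bounded below); the second is the lower bound. The value `p = ∞` is
included, with `1 / p = 0`. -/
theorem theorem1p1 (n : ℕ) (hn : 3 ≤ n) (p : ℝ≥0∞) (hp : 2 ≤ p) (m : ℕ) (hm : 1 ≤ m)
    (hmn : m ≤ n) :
    IsGLB {γ : ℝ | SchrodingerMaximal.IsAdmissible n p γ}
        (SchrodingerMaximal.optimalExponent n p) ∧
      ((n : ℝ) + m) / 2 * ((p⁻¹).toReal - 1 / 2) + (m : ℝ) / (2 * ((m : ℝ) + 1)) ≤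
        SchrodingerMaximal.optimalExponent n p :=
  theorem1p1_general hm hmn (two_pos.trans_le hp).ne'
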